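/- Let $d\ge 3$ be an integer, $\beta>0$, $\alpha\le 0$ and $0<b<a$. For $k\in\mathbb N=\{1,2,\dots\}$ put $$q_k=\frac{e^{\beta k\alpha}}{(4\pi\beta)^{d/2}k^{1+d/2}} .$$ On $\ell_1(\mathbb R_+)$, the set of summable sequences $x=(x_k)_{k\ge1}$ of nonnegative reals, let $D(x)=\sum_k kx_k\in[0,\infty]$ and, for $\mu\in\mathbb R$, $$F_\mu(x)=I_\alpha(x)+H_{\mu,\mathrm{lsc}}(x),\qquad I_\alpha(x)=\sum_{k}\frac{x_k}{\beta}\Big(\log\frac{x_k}{q_k}-1\Big)+\frac1\beta\sum_k q_k,$$ $$H_{\mu,\mathrm{lsc}}(x)=-\mu D(x)+\frac a2D(x)^2-\frac b2\sum_k k^2x_k^2-\frac{\big((\mu-aD(x))_+\big)^2}{2(a-b)},$$ with $H_{\mu,\mathrm{lsc}}(x)=+\infty$ if $D(x)=\infty$, so that $F_\mu$ takes values in $(-\infty,\infty]$. Let $W_0:[-e^{-1},\infty)\to[-1,\infty)$ be the principal branch of the Lambert function (the inverse of $w\mapsto we^w$ on $[-1,\infty)$). Assume $b\le (e\beta q_1)^{-1}$,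 so that the following function is well defined: $$h(x)=-\frac1{b\beta}\sum_{k=1}^\infty\frac1kW_0\Big(-b\beta k^2q_k\exp\Big(\frac{ab}{a-b}\beta kx\Big)\Big),\qquad x\le0 .$$ Put $\mu_{\mathrm p}=a\,h(0)$ and $\mu_{\mathrm{tang}}=a\inf_{x\le0}\{h(x)-x\}$. Assume further that $b<(\beta q_1)^{-1}e^{-\beta\mu_{\mathrm p}/a}$ and, if $d\ge5$ or $\alpha<0$, that $\lim_{x\uparrow0}h'(x)>1$ (the value $+\infty$ being allowed). Then there is a unique $\mu^*\in(\mu_{\mathrm{tang}},\mu_{\mathrm p})$ such that $F_\mu$ has a unique minimiser over $\ell_1(\mathbb R_+)$ for every $\mu<\mu^*$ and every $\mu>\mu^*$, and exactly two minimisers for $\mu=\mu^*$. The two minimisers $\xi^1,\xi^2$ of $F_{\mu^*}$ can be labelled so that $\infty>D(\xi^1)>\mu^*/a>D(\xi^2)$. Moreover $\mu\mapsto\inf F_\mu$ is finite on $\mathbb R$ and differentiable on $(-\infty,\mu^*)\cup(\mu^*,\infty)$, but it is not differentiable on any open neighbourhood of $\mu^*$. -/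

import Mathlib

open Set Filter Topology

namespace HYL

noncomputable section

/-- The cone `ℓ₁(ℝ₊)` of summable sequences `(x_k)_{k ≥ 1}` with nonnegative real entries. -/
abbrev Ell1Plus : Type :=
  {x : lp (fun _ : ℕ+ => ℝ) 1 // ∀ k, 0 ≤ x k}

/-- The weights `q_k^(α) = exp (β k α) / ((4 π β)^(d/2) k^(1 + d/2))`. -/
def q (d : ℕ) (β α : ℝ) (k : ℕ+) : ℝ :=
  Real.exp (β * (k : ℝ) * α) /
    ((4 * Real.pi * β) ^ ((d : ℝ) / 2) * (k : ℝ) ^ (1 + (d : ℝ) / 2))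

lemma q_pos (d : ℕ) {β : ℝ} (hβ : 0 < β) (α : ℝ) (k : ℕ+) : 0 < q d β α k := by
  have hk : (0 : ℝ) < (k : ℝ) := by exact_mod_cast k.pos
  have := Real.pi_pos
  unfold q
  positivity

/-- The terms of the rate function below are nonnegative, so that writing them with
`ENNReal.ofReal` loses nothing. -/
lemma rate_term_nonneg {t s : ℝ} (ht : 0 ≤ t) (hs : 0 < s) :
    0 ≤ t * (Real.log (t / s) - 1) + s := by
  rcases ht.eq_or_lt with rfl | ht
  · simpa using hs.le
  · have h := Real.log_le_sub_one_of_pos (div_pos hs ht)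
    have h2 : Real.log (s / t) = -Real.log (t / s) := by
      rw [← Real.log_inv, inv_div]
    rw [h2] at h
    have h3 : t * (s / t) = s := by field_simp
    nlinarith [mul_le_mul_of_nonneg_left h ht.le]

/-- The rate function of the ideal gas,
`I_α(x) = ∑_k (x_k / β) (log (x_k / q_k) - 1) + (∑_k q_k) / β`, with values in `[0, ∞]`.
The (convergent) sum of the `q_k` is distributed over the terms, which makes each of them
nonnegative (`rate_term_nonneg`). -/
def rate (d : ℕ) (β α : ℝ) (x : Ell1Plus) : ENNReal :=
  ∑' k : ℕ+, ENNReal.ofReal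
    ((x.1 k * (Real.log (x.1 k / q d β α k) - 1) + q d β α k) / β)

/-- The density `D(x) = ∑_k k x_k`, with values in `[0, ∞]`. -/
def density (x : Ell1Plus) : ENNReal :=
  ∑' k : ℕ+, ENNReal.ofReal ((k : ℝ) * x.1 k)

open Classical in
/-- The Hamiltonian
`H_μ(x) = -μ D(x) + (a/2) D(x)² - (b/2) ∑_k k² x_k²`. Since `a > b` and
`∑_k k² x_k² ≤ D(x)²`, it is `+∞` where `D(x) = ∞`; where `D(x) < ∞`, both series converge. -/
def ham (a b μ : ℝ) (x : Ell1Plus) : EReal :=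
  if density x = ⊤ then ⊤ else
    ((-μ * (density x).toReal + a / 2 * (density x).toReal ^ 2
      - b / 2 * ∑' k : ℕ+, (k : ℝ) ^ 2 * x.1 k ^ 2 : ℝ) : EReal)

open Classical in
/-- The lower semicontinuous regularisation
`H_{μ,lsc}(x) = H_μ(x) - (μ - a D(x))₊² / (2 (a - b))`; the subtracted term vanishes where
`D(x) = ∞`. -/
def hamLsc (a b μ : ℝ) (x : Ell1Plus) : EReal :=
  if density x = ⊤ then ⊤ else
    ham a b μ x -
      (((max (μ - a * (density x).toReal) 0) ^ 2 / (2 * (a - b)) : ℝ) : EReal)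

/-- The functional `F_μ = I_α + H_{μ,lsc}` on `ℓ₁(ℝ₊)`, with values in `(-∞, ∞]`. -/
def F (d : ℕ) (β α a b μ : ℝ) (x : Ell1Plus) : EReal :=
  (rate d β α x : EReal) + hamLsc a b μ x

/-- The set of global minimisers of `F_μ` over `ℓ₁(ℝ₊)`. -/
def minimisers (d : ℕ) (β α a b μ : ℝ) : Set Ell1Plus :=
  {x | ∀ y, F d β α a b μ x ≤ F d β α a b μ y}

/-- The principal real branch `W₀ : [-e⁻¹, ∞) → [-1, ∞)` of the Lambert function, that is the
inverse of `w ↦ w exp w` on `[-1, ∞)`. -/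
def lambertW0 : ℝ → ℝ :=
  Function.invFunOn (fun w : ℝ => w * Real.exp w) (Ici (-1))

/-- The function
`h(x) = -(1/(bβ)) ∑_k (1/k) W₀(-b β k² q_k exp ((ab/(a-b)) β k x))`, used for `x ≤ 0`. -/
def hTilde (d : ℕ) (β α a b x : ℝ) : ℝ :=
  -(1 / (b * β)) * ∑' k : ℕ+, 1 / (k : ℝ) *
    lambertW0 (-(b * β * (k : ℝ) ^ 2 * q d β α k *
      Real.exp (a * b / (a - b) * β * (k : ℝ) * x)))

/-- `μ_p = a h(0)`. -/
def muP (d : ℕ) (β α a b : ℝ) : ℝ := a * hTilde d β α a b 0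

/-- `μ_tang = a inf_{x ≤ 0} (h(x) - x)`. -/
def muTang (d : ℕ) (β α a b : ℝ) : ℝ :=
  a * sInf ((fun x : ℝ => hTilde d β α a b x - x) '' Iic 0)

/-- The slope condition `lim_{x ↑ 0} h'(x) > 1`, where the limit may be `+∞`. -/
def SlopeCondition (d : ℕ) (β α a b : ℝ) : Prop :=
  ∃ L : EReal,
    Tendsto (fun x : ℝ => ((deriv (hTilde d β α a b) x : ℝ) : EReal)) (𝓝[<] 0) (𝓝 L) ∧ 1 < L

end

end HYL

/-!
Write `s = D(x) - μ / a` and `κ = a b / (a - b)`. Completing the square turns `F_μ + μ² / (2 a)` into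
`Ψ(x) + φ(D(x))`, where `Ψ` is the rate function with the counter term `-(b / 2) ∑ k² x_k²` and
`φ = a s² / 2` for `s ≥ 0`, `φ = -κ s² / 2` for `s ≤ 0` (`shiftedF`, `densityCost`).

*Reduction to a box.* The regularised Hamiltonian allows density to be put on infinitely long cycles,
which costs no entropy. If `x_k > e q_k`, removing the cycles of length `k` in favour of such a
condensate strictly lowers the functional (`densityCost_sub_le`, `Regime.shiftedF_truncate_le`). So
only the box `x_k ≤ e q_k` matters, and `b ≤ (e β q_1)⁻¹` makes every summand of `Ψ` convex there.

*Duality on the box.* For a multiplier `l ≥ 0` the Lagrangian `Ψ + l D` has a unique minimiser over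
the box, coordinate by coordinate: the `profile`, given by the Lambert function
(`Regime.energyTerm_profile_lt`). Its density is `N(l) = h(-l / κ)` and the minimum is `P(l)`. The
function `N` is continuous, strictly decreasing and strictly convex, being a sum of inverses of the
strictly convex decreasing functions `u - log u`, and it is the derivative of `P`. Replacing the
parabolas in `φ` by tangents bounds the functional below by one-variable expressions in `l`: by
`gasObj` (concave, derivative `(a N(l) - l - μ) / a`) if `D(x) ≥ μ / a`, and by `condObj` (derivative
`(m(l) - μ) / a` with `m(l) = a (N(l) + l / κ)`) if `D(x) < μ / a`.

*Branches.* By convexity `m` decreases up to a point `lt` and increases afterwards, `m(lt) = μ_tang`,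
and `m(0) = μ_p`. The slope condition, or the divergence of the harmonic series if `d ≤ 4` and
`α = 0`, gives `lt > 0`. Hence the only candidates for a minimiser are the profile with the
multiplier `lg` solving `a N(l) - l = μ`, which exists for `μ ≤ μ_p`, and the one with the multiplier
`lc ≥ lt` solving `m(l) = μ`, which exists for `μ ≥ μ_tang` (`Regime.bound_or` and its companions).

*Transition.* Up to the common term `μ² / (2 a)`, the value of the first branch is a supremum of
affine functions of `μ`, that of the second an infimum, with slopes `-lg / a` and `-lc / a`. As
`lg < lc`, the difference of the values is strictly decreasing, and it changes sign between `μ_tang`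
and `μ_p` (`Branches.exists_crossing`). The crossing point is the critical parameter, and the infimum
has a corner there because the two slopes differ.
-/

namespace HYL

noncomputable section

/-! ### The Lambert function and one-dimensional entropy inequalities -/

lemma continuous_mul_exp : Continuous fun w : ℝ => w * Real.exp w := by fun_prop

/-- For `0 < z ≤ e⁻¹` the number `u = -W₀(-z)` is the solution in `(0, 1]` of `u exp (-u) = z`, here
in logarithmic form. -/
lemma lambertW0_spec {z : ℝ} (hz : 0 < z) (hz1 : z ≤ Real.exp (-1)) :
    0 < -lambertW0 (-z) ∧ -lambertW0 (-z) ≤ 1 ∧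
      Real.log (-lambertW0 (-z)) - (-lambertW0 (-z)) = Real.log z := by
  have hex : ∃ w ∈ Ici (-1 : ℝ), (fun w : ℝ => w * Real.exp w) w = -z := by
    have hivt := intermediate_value_Icc (show (-1 : ℝ) ≤ 0 by norm_num)
      continuous_mul_exp.continuousOn
    obtain ⟨w, hw, hwz⟩ := hivt (show -z ∈ Icc _ _ by constructor <;> norm_num <;> linarith)
    exact ⟨w, hw.1, hwz⟩
  have hmem : lambertW0 (-z) ∈ Ici (-1 : ℝ) := Function.invFunOn_mem hex
  have heq : lambertW0 (-z) * Real.exp (lambertW0 (-z)) = -z := Function.invFunOn_eq hex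
  set w := lambertW0 (-z)
  have hpos : 0 < -w := by
    by_contra hcon
    have : 0 ≤ w * Real.exp w := mul_nonneg (by linarith) (Real.exp_pos w).le
    linarith
  refine ⟨hpos, by have := mem_Ici.1 hmem; linarith, ?_⟩
  have hz' : z = -w * Real.exp w := by linarith
  rw [hz', Real.log_mul hpos.ne' (Real.exp_pos w).ne', Real.log_exp]
  ring

/-- The function `log t - 2 t + t² / 2` has derivative `(1 - t)² / t`. -/
lemma monotoneOn_log_sub : MonotoneOn (fun t : ℝ => Real.log t - 2 * t + t ^ 2 / 2) (Ioi 0) := by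
  have hder : ∀ t ∈ Ioi (0 : ℝ), HasDerivAt (fun t : ℝ => Real.log t - 2 * t + t ^ 2 / 2)
      (t⁻¹ - 2 + t) t := by
    intro t ht
    have h1 := (Real.hasDerivAt_log (ne_of_gt ht)).sub ((hasDerivAt_id t).const_mul 2)
    have h2 := h1.add ((hasDerivAt_pow 2 t).div_const 2)
    exact h2.congr_deriv (by simp)
  refine monotoneOn_of_deriv_nonneg (convex_Ioi 0)
    (fun t ht => (hder t ht).continuousAt.continuousWithinAt)
    (fun t ht => (hder t (interior_subset ht)).differentiableAt.differentiableWithinAt) ?_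
  intro t ht
  have ht := interior_subset ht
  rw [(hder t ht).deriv]
  have ht0 : (0 : ℝ) < t := ht
  have : t⁻¹ - 2 + t = (1 - t) ^ 2 / t := by field_simp; ring
  rw [this]; positivity

/-- Quantitative monotonicity of `log u - u` on `(0, 1]`. -/
lemma sq_le_log_sub {x y : ℝ} (hx : 0 < x) (hxy : x ≤ y) (hy : y ≤ 1) :
    (y - x) ^ 2 / 2 ≤ (Real.log y - y) - (Real.log x - x) := by
  have h := monotoneOn_log_sub (mem_Ioi.2 hx) (mem_Ioi.2 (hx.trans_le hxy)) hxy
  simp only at h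
  nlinarith

lemma strictMonoOn_log_sub : StrictMonoOn (fun u : ℝ => Real.log u - u) (Ioc 0 1) := by
  intro x hx y hy hxy
  have := sq_le_log_sub hx.1 hxy.le hy.2
  have : 0 < (y - x) ^ 2 := by have := sub_pos.2 hxy; positivity
  simp only; linarith

lemma strictConcaveOn_log_sub : StrictConcaveOn ℝ (Ioc 0 1) (fun u : ℝ => Real.log u - u) := by
  have h1 : StrictConcaveOn ℝ (Ioc (0 : ℝ) 1) Real.log :=
    strictConcaveOn_log_Ioi.subset (fun x hx => hx.1) (convex_Ioc 0 1)
  exact h1.sub_convexOn (convexOn_id (convex_Ioc 0 1))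

/-- On the unit interval the relative entropy dominates half of the squared distance. -/
lemma sq_lt_entropy {x y : ℝ} (hx : 0 ≤ x) (hx1 : x ≤ 1) (hy : 0 < y) (hy1 : y ≤ 1)
    (hne : x ≠ y) : (x - y) ^ 2 / 2 < x * Real.log (x / y) - x + y := by
  rcases hx.eq_or_lt with rfl | hx
  · simp; nlinarith
  have hder : ∀ t ∈ Ioi (0 : ℝ), HasDerivAt
      (fun t : ℝ => t * Real.log t - (Real.log y + 1) * t - (t - y) ^ 2 / 2)
      ((Real.log t - t) - (Real.log y - y)) t := by
    intro t ht
    have h1 := (Real.hasDerivAt_mul_log (ne_of_gt ht)).sub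
      ((hasDerivAt_id t).const_mul (Real.log y + 1))
    have h2 := h1.sub ((((hasDerivAt_id t).sub_const y).pow 2).div_const 2)
    exact h2.congr_deriv (by simp; ring)
  have key : y * Real.log y - (Real.log y + 1) * y - (y - y) ^ 2 / 2 <
      x * Real.log x - (Real.log y + 1) * x - (x - y) ^ 2 / 2 := by
    rcases lt_or_gt_of_ne hne with hlt | hlt
    · have hanti := strictAntiOn_of_deriv_neg (convex_Icc x y)
        (f := fun t : ℝ => t * Real.log t - (Real.log y + 1) * t - (t - y) ^ 2 / 2)
        (fun t ht => (hder t (hx.trans_le ht.1)).continuousAt.continuousWithinAt)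
        (fun t ht => by
          rw [interior_Icc] at ht
          rw [(hder t (hx.trans ht.1)).deriv, sub_neg]
          exact strictMonoOn_log_sub ⟨hx.trans ht.1, ht.2.le.trans hy1⟩ ⟨hy, hy1⟩ ht.2)
      exact hanti (left_mem_Icc.2 hlt.le) (right_mem_Icc.2 hlt.le) hlt
    · have hmono := strictMonoOn_of_deriv_pos (convex_Icc y x)
        (f := fun t : ℝ => t * Real.log t - (Real.log y + 1) * t - (t - y) ^ 2 / 2)
        (fun t ht => (hder t (hy.trans_le ht.1)).continuousAt.continuousWithinAt)
        (fun t ht => by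
          rw [interior_Icc] at ht
          rw [(hder t (hy.trans ht.1)).deriv, sub_pos]
          exact strictMonoOn_log_sub ⟨hy, hy1⟩ ⟨hy.trans ht.1, ht.2.le.trans hx1⟩ ht.1)
      exact hmono (left_mem_Icc.2 hlt.le) (right_mem_Icc.2 hlt.le) hlt
  rw [Real.log_div hx.ne' hy.ne']
  nlinarith

/-! ### The one-parameter dual problem -/

/-- A function with a subgradient that is continuous at a point is differentiable there. -/
lemma hasDerivWithinAt_of_subgradient {s : Set ℝ} {w g : ℝ → ℝ} {x : ℝ} (hx : x ∈ s)
    (hw : ∀ x ∈ s, ∀ y ∈ s, w x + g x * (y - x) ≤ w y) (hg : ContinuousWithinAt g s x) :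
    HasDerivWithinAt w (g x) s x := by
  rw [hasDerivWithinAt_iff_isLittleO, Asymptotics.isLittleO_iff]
  intro c hc
  filter_upwards [Metric.continuousWithinAt_iff'.1 hg c hc, self_mem_nhdsWithin] with y hy hys
  rw [Real.dist_eq] at hy
  have h1 := hw x hx y hys
  have h2 := hw y hys x hx
  rw [smul_eq_mul, Real.norm_eq_abs, Real.norm_eq_abs]
  have h3 : |w y - w x - (y - x) * g x| ≤ |(g y - g x) * (y - x)| := by
    rw [abs_of_nonneg (by linarith)]
    exact le_trans (by linarith) (le_abs_self _)
  refine h3.trans ?_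
  rw [abs_mul]
  exact mul_le_mul_of_nonneg_right hy.le (abs_nonneg _)

/-- A density `N` and a dual function `P` on `[0, ∞)`, `N` being a supergradient of `P`. -/
structure DualPair (N P : ℝ → ℝ) : Prop where
  cont : ContinuousOn N (Ici 0)
  anti : StrictAntiOn N (Ici 0)
  conv : StrictConvexOn ℝ (Ici 0) N
  pos : ∀ l, 0 ≤ l → 0 < N l
  le_add : ∀ l, 0 ≤ l → ∀ l', 0 ≤ l' → P l' ≤ P l + (l' - l) * N l

/-- The chemical potential `m(l) = a (N(l) + r l)` at which the profile with multiplier `l` is a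
critical point with a condensate; `r` stands for `1 / b - 1 / a`. -/
def critPot (N : ℝ → ℝ) (a r l : ℝ) : ℝ := a * (N l + r * l)

/-- The concave dual objective for densities of at least `μ / a`. -/
def gasObj (P : ℝ → ℝ) (a μ l : ℝ) : ℝ := P l - l * μ / a - l ^ 2 / (2 * a)

/-- The dual objective for densities below `μ / a`; its derivative in `l` is `(m(l) - μ) / a`. -/
def condObj (P : ℝ → ℝ) (a r μ l : ℝ) : ℝ := P l - l * μ / a + r * l ^ 2 / 2

/-- The branches of critical multipliers: `lg μ` solves `a N(l) - l = μ`, and `lc μ` is the solution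
of `m(l) = μ` to the right of the minimiser `lt` of `m`. -/
structure Branches (N : ℝ → ℝ) (a r lt : ℝ) (lg lc : ℝ → ℝ) : Prop where
  lt_nonneg : 0 ≤ lt
  min : ∀ l, 0 ≤ l → critPot N a r lt ≤ critPot N a r l
  gas : ∀ μ ≤ a * N 0, 0 ≤ lg μ ∧ a * N (lg μ) - lg μ = μ
  cond : ∀ μ, critPot N a r lt ≤ μ → lt ≤ lc μ ∧ critPot N a r (lc μ) = μ

section Dual

variable {N P : ℝ → ℝ} {a r lt : ℝ} {lg lc : ℝ → ℝ} (D : DualPair N P) (ha : 0 < a) (hr : 0 < r)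

include D in
lemma DualPair.hasDerivWithinAt {l : ℝ} (hl : 0 ≤ l) : HasDerivWithinAt P (N l) (Ici 0) l := by
  have := hasDerivWithinAt_of_subgradient (s := Ici 0) (w := fun l => -P l) (g := fun l => -N l)
    (x := l) hl (fun x hx y hy => by have := D.le_add x hx y hy; linarith) (D.cont.neg l hl)
  simpa using this.fun_neg

include D in
lemma DualPair.critPot_continuousOn : ContinuousOn (critPot N a r) (Ici 0) := by
  unfold critPot
  exact continuousOn_const.mul (D.cont.add (by fun_prop))

include D ha in
lemma DualPair.hasDerivWithinAt_condObj (μ : ℝ) {l : ℝ} (hl : 0 ≤ l) :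
    HasDerivWithinAt (condObj P a r μ) ((critPot N a r l - μ) / a) (Ici 0) l := by
  have h1 := ((hasDerivAt_id l).mul_const μ).div_const a
  have h2 := (((hasDerivAt_pow 2 l)).const_mul r).div_const 2
  have h3 := ((D.hasDerivWithinAt hl).sub h1.hasDerivWithinAt).add h2.hasDerivWithinAt
  refine h3.congr_deriv ?_
  simp only [critPot]
  field_simp
  norm_num
  ring

include D ha hr in
/-- The function `m` is continuous and coercive, so that it attains its minimum. -/
lemma DualPair.exists_argmin : ∃ lt, 0 ≤ lt ∧ ∀ l, 0 ≤ l → critPot N a r lt ≤ critPot N a r l := by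
  have hN0 := D.pos 0 le_rfl
  obtain ⟨lt, hlt, hmin⟩ := isCompact_Icc.exists_isMinOn
    (nonempty_Icc.2 (show (0 : ℝ) ≤ N 0 / r by positivity))
    ((D.critPot_continuousOn (a := a) (r := r)).mono Icc_subset_Ici_self)
  refine ⟨lt, hlt.1, fun l hl => ?_⟩
  rcases le_total l (N 0 / r) with h | h
  · exact hmin ⟨hl, h⟩
  · refine (hmin (left_mem_Icc.2 (by positivity))).trans ?_
    rw [div_le_iff₀ hr] at h
    have := D.pos l hl
    unfold critPot
    refine mul_le_mul_of_nonneg_left ?_ ha.le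
    linarith

include D ha in
lemma DualPair.critPot_strictConvexOn : StrictConvexOn ℝ (Ici 0) (critPot N a r) := by
  refine ⟨convex_Ici 0, fun x hx y hy hne s t hs ht hst => ?_⟩
  have := mul_lt_mul_of_pos_left (D.conv.2 hx hy hne hs ht hst) ha
  simp only [critPot, smul_eq_mul] at this ⊢
  linarith

include D ha hr in
lemma DualPair.exists_branches : ∃ lt lg lc, Branches N a r lt lg lc := by
  obtain ⟨lt, hlt, hmin⟩ := D.exists_argmin ha hr
  have hgas : ∀ μ : ℝ, ∃ l, μ ≤ a * N 0 → 0 ≤ l ∧ a * N l - l = μ := by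
    intro μ
    by_cases hμ : μ ≤ a * N 0
    · have hle : 0 ≤ a * N 0 - μ := by linarith
      have hcont : ContinuousOn (fun l => a * N l - l) (Icc 0 (a * N 0 - μ)) :=
        ((continuousOn_const.mul D.cont).sub continuousOn_id).mono Icc_subset_Ici_self
      have hN := mul_le_mul_of_nonneg_left (D.anti.antitoneOn self_mem_Ici hle hle) ha.le
      obtain ⟨l, hl, hlμ⟩ := intermediate_value_Icc' hle hcont
        (show μ ∈ Icc _ _ from ⟨by linarith, by linarith⟩)
      exact ⟨l, fun _ => ⟨hl.1, hlμ⟩⟩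
    · exact ⟨0, fun h => absurd h hμ⟩
  have hcond : ∀ μ : ℝ, ∃ l, critPot N a r lt ≤ μ → lt ≤ l ∧ critPot N a r l = μ := by
    intro μ
    by_cases hμ : critPot N a r lt ≤ μ
    · have hle : lt ≤ lt + |μ| / (a * r) := by
        have : 0 ≤ |μ| / (a * r) := by positivity
        linarith
      have hcont := (D.critPot_continuousOn (a := a) (r := r)).mono
        (show Icc lt (lt + |μ| / (a * r)) ⊆ Ici 0 from fun x hx => hlt.trans hx.1)
      have hbig : μ ≤ critPot N a r (lt + |μ| / (a * r)) := by
        have h1 := D.pos (lt + |μ| / (a * r)) (hlt.trans hle)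
        have h2 : a * (r * (|μ| / (a * r))) = |μ| := by field_simp
        have h3 := le_abs_self μ
        unfold critPot
        have h4 : 0 ≤ a * (r * lt) := by positivity
        have h5 := mul_pos ha h1
        linarith
      obtain ⟨l, hl, hlμ⟩ := intermediate_value_Icc hle hcont ⟨hμ, hbig⟩
      exact ⟨l, fun _ => ⟨hl.1, hlμ⟩⟩
    · exact ⟨0, fun h => absurd h hμ⟩
  choose lg hlg using hgas
  choose lc hlc using hcond
  exact ⟨lt, lg, lc, hlt, hmin, hlg, hlc⟩

variable (B : Branches N a r lt lg lc)

include D ha B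

lemma Branches.critPot_strictMonoOn : StrictMonoOn (critPot N a r) (Ici lt) := by
  intro x hx y hy hxy
  have hx0 : 0 ≤ x := B.lt_nonneg.trans hx
  have hy0 : 0 ≤ y := B.lt_nonneg.trans hy
  by_contra! hcon
  -- the value at the midpoint of `lt` and `y`, or at `x` itself, would be below the minimum
  have hlty : lt ≠ y := (lt_of_le_of_lt hx hxy).ne
  rcases (mem_Ici.1 hx).eq_or_lt with rfl | hltx
  · have := (D.critPot_strictConvexOn ha (r := r)).2 B.lt_nonneg hy0 hlty
      (show (0 : ℝ) < 1 / 2 by norm_num) (show (0 : ℝ) < 1 / 2 by norm_num) (by norm_num)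
    have hm := B.min ((1 / 2 : ℝ) • lt + (1 / 2 : ℝ) • y) (by
      simp only [smul_eq_mul]
      have := B.lt_nonneg
      linarith)
    simp only [smul_eq_mul] at this hm
    linarith
  · have := (D.critPot_strictConvexOn ha (r := r)).lt_on_openSegment B.lt_nonneg hy0 hlty
      (show x ∈ openSegment ℝ lt y by
        rw [openSegment_eq_Ioo (hltx.trans hxy)]; exact ⟨hltx, hxy⟩)
    rw [lt_max_iff] at this
    rcases this with h1 | h1
    · exact absurd (B.min x hx0) (not_le.2 h1)
    · linarith

lemma Branches.critPot_strictAntiOn : StrictAntiOn (critPot N a r) (Icc 0 lt) := by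
  intro x hx y hy hxy
  by_contra! hcon
  have hltx : x ≠ lt := (lt_of_lt_of_le hxy hy.2).ne
  rcases hy.2.eq_or_lt with rfl | hylt
  · have := (D.critPot_strictConvexOn ha (r := r)).2 hx.1 B.lt_nonneg hltx
      (show (0 : ℝ) < 1 / 2 by norm_num) (show (0 : ℝ) < 1 / 2 by norm_num) (by norm_num)
    have hm := B.min ((1 / 2 : ℝ) • x + (1 / 2 : ℝ) • y) (by
      simp only [smul_eq_mul]
      linarith [hx.1])
    simp only [smul_eq_mul] at this hm
    linarith
  · have := (D.critPot_strictConvexOn ha (r := r)).lt_on_openSegment hx.1 B.lt_nonneg hltx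
      (show y ∈ openSegment ℝ x lt by
        rw [openSegment_eq_Ioo (hxy.trans hylt)]; exact ⟨hxy, hylt⟩)
    rw [lt_max_iff] at this
    rcases this with h1 | h1
    · linarith
    · exact absurd (B.min y hy.1) (not_le.2 h1)

omit B in
lemma DualPair.strictMonoOn_condObj {μ x y : ℝ} (hx : 0 ≤ x)
    (h : ∀ l ∈ Ioo x y, μ < critPot N a r l) : StrictMonoOn (condObj P a r μ) (Icc x y) := by
  refine strictMonoOn_of_deriv_pos (convex_Icc x y) (fun l hl =>
    ((D.hasDerivWithinAt_condObj ha μ (hx.trans hl.1)).continuousWithinAt).mono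
      (fun z hz => hx.trans hz.1)) (fun l hl => ?_)
  rw [interior_Icc] at hl
  have hl0 : 0 < l := hx.trans_lt hl.1
  rw [((D.hasDerivWithinAt_condObj ha μ hl0.le).hasDerivAt (Ici_mem_nhds hl0)).deriv]
  exact div_pos (sub_pos.2 (h l hl)) ha

omit B in
lemma DualPair.strictAntiOn_condObj {μ x y : ℝ} (hx : 0 ≤ x)
    (h : ∀ l ∈ Ioo x y, critPot N a r l < μ) : StrictAntiOn (condObj P a r μ) (Icc x y) := by
  refine strictAntiOn_of_deriv_neg (convex_Icc x y) (fun l hl =>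
    ((D.hasDerivWithinAt_condObj ha μ (hx.trans hl.1)).continuousWithinAt).mono
      (fun z hz => hx.trans hz.1)) (fun l hl => ?_)
  rw [interior_Icc] at hl
  have hl0 : 0 < l := hx.trans_lt hl.1
  rw [((D.hasDerivWithinAt_condObj ha μ hl0.le).hasDerivAt (Ici_mem_nhds hl0)).deriv]
  exact div_neg_of_neg_of_pos (sub_neg.2 (h l hl)) ha

lemma Branches.condObj_lt {μ l : ℝ} (hμ : critPot N a r lt ≤ μ) (hl : lt ≤ l) (hne : l ≠ lc μ) :
    condObj P a r μ (lc μ) < condObj P a r μ l := by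
  obtain ⟨h1, h2⟩ := B.cond μ hμ
  have hmono := B.critPot_strictMonoOn D ha
  rcases lt_or_gt_of_ne hne with hlt | hlt
  · refine D.strictAntiOn_condObj ha (x := l) (y := lc μ) (B.lt_nonneg.trans hl) (fun z hz => ?_)
      (left_mem_Icc.2 hlt.le) (right_mem_Icc.2 hlt.le) hlt
    rw [← h2]
    exact hmono (hl.trans hz.1.le) h1 hz.2
  · refine D.strictMonoOn_condObj ha (x := lc μ) (y := l) (B.lt_nonneg.trans h1) (fun z hz => ?_)
      (left_mem_Icc.2 hlt.le) (right_mem_Icc.2 hlt.le) hlt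
    nth_rewrite 1 [← h2]
    exact hmono h1 (h1.trans hz.1.le) hz.1

lemma Branches.condObj_le {μ l : ℝ} (hμ : critPot N a r lt ≤ μ) (hl : lt ≤ l) :
    condObj P a r μ (lc μ) ≤ condObj P a r μ l := by
  by_cases h : l = lc μ
  · rw [h]
  · exact (B.condObj_lt D ha hμ hl h).le

/-- To the left of `lt` the objective first increases and then decreases. -/
lemma Branches.condObj_le_or {μ x l : ℝ} (hx : 0 ≤ x) (hxl : x ≤ l) (hl : l ≤ lt) :
    condObj P a r μ x ≤ condObj P a r μ l ∨ condObj P a r μ lt ≤ condObj P a r μ l := by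
  have hanti := B.critPot_strictAntiOn D ha
  have hl0 := hx.trans hxl
  rcases le_total μ (critPot N a r l) with h | h
  · left
    refine (D.strictMonoOn_condObj ha hx (fun z hz => ?_)).monotoneOn (left_mem_Icc.2 hxl)
      (right_mem_Icc.2 hxl) hxl
    exact h.trans_lt (hanti ⟨hx.trans hz.1.le, hz.2.le.trans hl⟩ ⟨hl0, hl⟩ hz.2)
  · right
    refine (D.strictAntiOn_condObj ha hl0 (fun z hz => ?_)).antitoneOn (left_mem_Icc.2 hl)
      (right_mem_Icc.2 hl) hl
    exact (hanti ⟨hl0, hl⟩ ⟨hl0.trans hz.1.le, hz.2.le⟩ hz.1).trans_le h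

/-- Up to the tangential potential the objective increases throughout. -/
lemma Branches.condObj_mono {μ x l : ℝ} (hμ : μ ≤ critPot N a r lt) (hx : 0 ≤ x) (hxl : x ≤ l) :
    condObj P a r μ x ≤ condObj P a r μ l := by
  have hright : ∀ y z, lt ≤ y → y ≤ z → condObj P a r μ y ≤ condObj P a r μ z := by
    intro y z hy hyz
    refine (D.strictMonoOn_condObj ha (B.lt_nonneg.trans hy) (fun w hw => ?_)).monotoneOn
      (left_mem_Icc.2 hyz) (right_mem_Icc.2 hyz) hyz
    exact hμ.trans_lt (B.critPot_strictMonoOn D ha self_mem_Ici (hy.trans hw.1.le)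
      (hy.trans_lt hw.1))
  have hleft : ∀ y z, 0 ≤ y → y ≤ z → z ≤ lt → condObj P a r μ y ≤ condObj P a r μ z := by
    intro y z hy hyz hz
    refine (D.strictMonoOn_condObj ha hy (fun w hw => ?_)).monotoneOn
      (left_mem_Icc.2 hyz) (right_mem_Icc.2 hyz) hyz
    exact hμ.trans_lt (B.critPot_strictAntiOn D ha ⟨hy.trans hw.1.le, hw.2.le.trans hz⟩
      (right_mem_Icc.2 B.lt_nonneg) (hw.2.trans_le hz))
  rcases le_total l lt with h | h
  · exact hleft x l hx hxl h
  · rcases le_total lt x with h' | h'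
    · exact hright x l h' hxl
    · exact (hleft x lt hx h' le_rfl).trans (hright lt l le_rfl h)

/-- From `m(0)` on, the objective decreases up to `lc μ`. -/
lemma Branches.condObj_lt_of_le {μ l : ℝ} (hlt : 0 < lt) (hμ : a * N 0 ≤ μ) (hl : 0 ≤ l)
    (hne : l ≠ lc μ) : condObj P a r μ (lc μ) < condObj P a r μ l := by
  have hm0 : critPot N a r 0 = a * N 0 := by simp [critPot]
  have hμt : critPot N a r lt ≤ μ := (B.min 0 le_rfl).trans (hm0.le.trans hμ)
  rcases le_total lt l with h | h
  · exact B.condObj_lt D ha hμt h hne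
  · rcases h.eq_or_lt with rfl | h
    · exact B.condObj_lt D ha hμt le_rfl hne
    · refine lt_of_le_of_lt (B.condObj_le D ha hμt le_rfl) ?_
      refine D.strictAntiOn_condObj ha hl (fun z hz => ?_) (left_mem_Icc.2 h.le)
        (right_mem_Icc.2 h.le) h
      refine lt_of_lt_of_le ?_ (hm0.le.trans hμ)
      exact B.critPot_strictAntiOn D ha ⟨le_rfl, B.lt_nonneg⟩ ⟨(hl.trans hz.1.le), hz.2.le⟩
        (hl.trans_lt hz.1)

lemma Branches.gasObj_le {μ l : ℝ} (hμ : μ ≤ a * N 0) (hl : 0 ≤ l) :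
    gasObj P a μ l ≤ gasObj P a μ (lg μ) := by
  obtain ⟨h1, h2⟩ := B.gas μ hμ
  have h3 := D.le_add _ h1 _ hl
  have h4 : N (lg μ) = (μ + lg μ) / a := by field_simp; linarith
  rw [h4] at h3
  have h5 : gasObj P a μ (lg μ) - gasObj P a μ l =
      P (lg μ) + (l - lg μ) * ((μ + lg μ) / a) - P l + (l - lg μ) ^ 2 / (2 * a) := by
    unfold gasObj
    field_simp
    ring
  have h6 : 0 ≤ (l - lg μ) ^ 2 / (2 * a) := by positivity
  linarith

/-- The value of the gas branch is convex in `μ`. -/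
lemma Branches.gasValue_subgradient {μ ν : ℝ} (hμ : μ ≤ a * N 0) (hν : ν ≤ a * N 0) :
    gasObj P a μ (lg μ) + -(lg μ / a) * (ν - μ) ≤ gasObj P a ν (lg ν) := by
  refine le_trans (le_of_eq ?_) (B.gasObj_le D ha hν (B.gas μ hμ).1)
  unfold gasObj
  field_simp
  ring

/-- The value of the condensed branch is concave in `μ`. -/
lemma Branches.condValue_supergradient {μ ν : ℝ} (hμ : critPot N a r lt ≤ μ)
    (hν : critPot N a r lt ≤ ν) :
    condObj P a r ν (lc ν) ≤ condObj P a r μ (lc μ) + -(lc μ / a) * (ν - μ) := by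
  refine (B.condObj_le D ha hν (B.cond μ hμ).1).trans (le_of_eq ?_)
  unfold condObj
  field_simp
  ring

lemma Branches.gas_continuousOn : ContinuousOn lg (Iic (a * N 0)) := by
  have hle : ∀ x ∈ Iic (a * N 0), ∀ y ∈ Iic (a * N 0), x ≤ y → lg y ≤ lg x ∧ lg x - lg y ≤ y - x := by
    intro x hx y hy hxy
    obtain ⟨hx1, hx2⟩ := B.gas x hx
    obtain ⟨hy1, hy2⟩ := B.gas y hy
    have h1 : lg y ≤ lg x := by
      by_contra! hcon
      have := mul_lt_mul_of_pos_left (D.anti hx1 hy1 hcon) ha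
      linarith
    refine ⟨h1, ?_⟩
    have := mul_le_mul_of_nonneg_left (D.anti.antitoneOn hy1 hx1 h1) ha.le
    linarith
  have : LipschitzOnWith 1 lg (Iic (a * N 0)) := by
    refine LipschitzOnWith.of_dist_le_mul fun x hx y hy => ?_
    rw [NNReal.coe_one, one_mul, Real.dist_eq, Real.dist_eq]
    rcases le_total x y with hxy | hxy
    · obtain ⟨h1, h2⟩ := hle x hx y hy hxy
      rw [abs_of_nonneg (sub_nonneg.2 h1), abs_of_nonpos (sub_nonpos.2 hxy)]
      linarith
    · obtain ⟨h1, h2⟩ := hle y hy x hx hxy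
      rw [abs_of_nonpos (sub_nonpos.2 h1), abs_of_nonneg (sub_nonneg.2 hxy)]
      linarith
  exact this.continuousOn

lemma Branches.cond_eq {l : ℝ} (hl : lt ≤ l) : lc (critPot N a r l) = l := by
  have hmono := B.critPot_strictMonoOn D ha
  obtain ⟨h1, h2⟩ := B.cond (critPot N a r l) (hmono.monotoneOn self_mem_Ici hl hl)
  exact hmono.injOn h1 hl h2

lemma Branches.cond_strictMonoOn : StrictMonoOn lc (Ici (critPot N a r lt)) := by
  intro x hx y hy hxy
  obtain ⟨hx1, hx2⟩ := B.cond x hx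
  obtain ⟨hy1, hy2⟩ := B.cond y hy
  rw [← (B.critPot_strictMonoOn D ha).lt_iff_lt hx1 hy1, hx2, hy2]
  exact hxy

lemma Branches.cond_continuousAt {μ : ℝ} (hμ : critPot N a r lt < μ) : ContinuousAt lc μ := by
  refine continuousAt_of_monotoneOn_of_image_mem_nhds (B.cond_strictMonoOn D ha).monotoneOn
    (Ici_mem_nhds hμ) ?_
  have hlt : lt < lc μ := by
    obtain ⟨h1, h2⟩ := B.cond μ hμ.le
    refine h1.lt_of_ne fun he => ?_
    rw [← he] at h2
    exact hμ.ne h2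
  refine mem_of_superset (Ici_mem_nhds hlt) fun l hl => ?_
  exact ⟨critPot N a r l,
    (B.critPot_strictMonoOn D ha).monotoneOn self_mem_Ici hl hl, B.cond_eq D ha hl⟩

lemma Branches.gasValue_hasDerivAt {μ : ℝ} (hμ : μ < a * N 0) :
    HasDerivAt (fun ν => gasObj P a ν (lg ν)) (-(lg μ / a)) μ :=
  (hasDerivWithinAt_of_subgradient (g := fun ν => -(lg ν / a)) (mem_Iic.2 hμ.le)
    (fun _ hx _ hy => B.gasValue_subgradient D ha hx hy)
    ((B.gas_continuousOn D ha).div_const a |>.neg μ hμ.le)).hasDerivAt (Iic_mem_nhds hμ)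

lemma Branches.condValue_hasDerivAt {μ : ℝ} (hμ : critPot N a r lt < μ) :
    HasDerivAt (fun ν => condObj P a r ν (lc ν)) (-(lc μ / a)) μ := by
  have h1 := hasDerivWithinAt_of_subgradient (s := Ici (critPot N a r lt))
    (w := fun ν => -condObj P a r ν (lc ν)) (g := fun ν => lc ν / a) hμ.le
    (fun x hx y hy => by have := B.condValue_supergradient D ha hx hy; linarith)
    ((B.cond_continuousAt D ha hμ).div_const a).continuousWithinAt
  simpa using (h1.hasDerivAt (Ici_mem_nhds hμ)).fun_neg

include hr in
lemma Branches.gas_lt_cond {μ : ℝ} (hlt : 0 < lt) (hμt : critPot N a r lt ≤ μ)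
    (hμ : μ ≤ a * N 0) : lg μ < lc μ := by
  obtain ⟨h1, h2⟩ := B.gas μ hμ
  obtain ⟨h3, h4⟩ := B.cond μ hμt
  have h5 : 0 < lc μ := hlt.trans_le h3
  rw [← D.anti.lt_iff_gt h5.le h1]
  unfold critPot at h4
  have h6 : 0 < a * (r * lc μ) := by positivity
  have : a * N (lc μ) < a * N (lg μ) := by linarith
  exact lt_of_mul_lt_mul_left this ha.le

omit D ha in
lemma Branches.gas_pos {μ : ℝ} (hμ : μ < a * N 0) : 0 < lg μ := by
  obtain ⟨h1, h2⟩ := B.gas μ hμ.le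
  refine h1.lt_of_ne fun he => ?_
  rw [← he] at h2
  linarith

omit D B in
lemma gasObj_le_condObj (hr : 0 < r) {μ l : ℝ} :
    gasObj P a μ l ≤ condObj P a r μ l ∧ (0 < l → gasObj P a μ l < condObj P a r μ l) := by
  have e : condObj P a r μ l - gasObj P a μ l = (r + 1 / a) * l ^ 2 / 2 := by
    unfold condObj gasObj
    field_simp
    ring
  refine ⟨?_, fun hl => ?_⟩
  · have : 0 ≤ (r + 1 / a) * l ^ 2 / 2 := by positivity
    linarith
  · have : 0 < (r + 1 / a) * l ^ 2 / 2 := by positivity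
    linarith

include hr in
/-- The values of the two branches cross exactly once: the difference is strictly decreasing, since
`lg < lc`, and it changes sign. -/
lemma Branches.exists_crossing (hlt : 0 < lt) :
    ∃ μs ∈ Ioo (critPot N a r lt) (a * N 0),
      gasObj P a μs (lg μs) = condObj P a r μs (lc μs) ∧
      (∀ μ ∈ Ico (critPot N a r lt) μs, gasObj P a μ (lg μ) < condObj P a r μ (lc μ)) ∧
      (∀ μ ∈ Ioc μs (a * N 0), condObj P a r μ (lc μ) < gasObj P a μ (lg μ)) := by
  have hm0 : critPot N a r 0 = a * N 0 := by simp [critPot]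
  have htp : critPot N a r lt < a * N 0 := by
    rw [← hm0]
    exact B.critPot_strictAntiOn D ha (left_mem_Icc.2 hlt.le) (right_mem_Icc.2 hlt.le) hlt
  set μt := critPot N a r lt with hμt
  set μp := a * N 0 with hμp
  set v : ℝ → ℝ := fun μ => condObj P a r μ (lc μ) - gasObj P a μ (lg μ) with hv
  have hstep : ∀ x ∈ Icc μt μp, ∀ y ∈ Icc μt μp,
      v y - v x ≤ -((lc x - lg x) / a) * (y - x) := by
    intro x hx y hy
    have h1 := B.gasValue_subgradient D ha hx.2 hy.2
    have h2 := B.condValue_supergradient D ha hx.1 hy.1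
    have e : -((lc x - lg x) / a) * (y - x) = -(lc x / a) * (y - x) - -(lg x / a) * (y - x) := by
      ring
    simp only [hv]
    linarith
  have hanti : StrictAntiOn v (Icc μt μp) := by
    intro x hx y hy hxy
    have h1 := hstep x hx y hy
    have h2 : 0 < (lc x - lg x) / a * (y - x) :=
      mul_pos (div_pos (sub_pos.2 (B.gas_lt_cond D ha hr hlt hx.1 hx.2)) ha) (sub_pos.2 hxy)
    linarith
  have hcont : ContinuousOn v (Icc μt μp) := by
    set C := lc μp / a
    have hC0 : 0 ≤ C := div_nonneg (hlt.le.trans (B.cond μp htp.le).1) ha.le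
    have hC : ∀ x ∈ Icc μt μp, (lc x - lg x) / a ≤ C := by
      intro x hx
      refine div_le_div_of_nonneg_right ?_ ha.le
      have h1 := (B.cond_strictMonoOn D ha).monotoneOn hx.1 htp.le hx.2
      have h2 := (B.gas x hx.2).1
      linarith
    have : LipschitzOnWith C.toNNReal v (Icc μt μp) := by
      refine LipschitzOnWith.of_dist_le_mul fun x hx y hy => ?_
      rw [Real.dist_eq, Real.dist_eq, Real.coe_toNNReal C hC0]
      rcases le_total x y with hxy | hxy
      · have h1 := hstep y hy x hx
        have h2 := mul_le_mul_of_nonneg_right (hC y hy) (sub_nonneg.2 hxy)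
        rw [abs_of_nonneg (sub_nonneg.2 (hanti.antitoneOn hx hy hxy)),
          abs_of_nonpos (sub_nonpos.2 hxy)]
        linarith
      · have h1 := hstep x hx y hy
        have h2 := mul_le_mul_of_nonneg_right (hC x hx) (sub_nonneg.2 hxy)
        rw [abs_of_nonpos (sub_nonpos.2 (hanti.antitoneOn hy hx hxy)),
          abs_of_nonneg (sub_nonneg.2 hxy)]
        linarith
    exact this.continuousOn
  have hvt : 0 < v μt := by
    have h1 := B.gas_pos htp
    have h2 := (gasObj_le_condObj ha hr (P := P) (μ := μt) (l := lg μt)).2 h1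
    have h3 := B.condObj_mono D ha le_rfl h1.le (B.gas_lt_cond D ha hr hlt le_rfl htp.le).le
    simp only [hv]
    linarith
  have hvp : v μp < 0 := by
    have h0 : lg μp = 0 := by
      obtain ⟨h1, h2⟩ := B.gas μp le_rfl
      by_contra hne
      have := mul_lt_mul_of_pos_left (D.anti self_mem_Ici h1 (h1.lt_of_ne (Ne.symm hne))) ha
      linarith
    have h1 := B.condObj_lt_of_le D ha hlt le_rfl le_rfl
      (hlt.trans_le (B.cond μp htp.le).1).ne
    have h2 : gasObj P a μp 0 = condObj P a r μp 0 := by simp [gasObj, condObj]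
    simp only [hv, h0]
    linarith
  obtain ⟨μs, hμs, hvs⟩ := intermediate_value_Icc' htp.le hcont ⟨hvp.le, hvt.le⟩
  have hl : μt < μs := hμs.1.lt_of_ne (by rintro rfl; linarith)
  have hrt : μs < μp := hμs.2.lt_of_ne (by rintro rfl; linarith)
  refine ⟨μs, ⟨hl, hrt⟩, (sub_eq_zero.1 hvs).symm, fun μ hμ => ?_, fun μ hμ => ?_⟩
  · have := hanti ⟨hμ.1, hμ.2.le.trans hμs.2⟩ hμs hμ.2
    rw [hvs] at this
    exact sub_pos.1 this
  · have := hanti hμs ⟨hμs.1.trans hμ.1.le, hμ.2⟩ hμ.1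
    rw [hvs] at this
    exact sub_neg.1 this

end Dual

variable {d : ℕ} {β α a b : ℝ}

/-! ### Weights and cycle occupations -/

/-- The standing conditions on the parameters. -/
structure Regime (d : ℕ) (β α a b : ℝ) : Prop where
  three_le : 3 ≤ d
  beta_pos : 0 < β
  alpha_nonpos : α ≤ 0
  b_pos : 0 < b
  b_lt : b < a
  b_le : b ≤ 1 / (Real.exp 1 * β * q d β α 1)


lemma Regime.a_pos (h : Regime d β α a b) : 0 < a := h.b_pos.trans h.b_lt

lemma Regime.q_pos (h : Regime d β α a b) (k : ℕ+) : 0 < q d β α k := HYL.q_pos d h.beta_pos α k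

lemma one_le_pnat (k : ℕ+) : (1 : ℝ) ≤ k := by exact_mod_cast k.2

lemma pnat_pos (k : ℕ+) : (0 : ℝ) < k := by exact_mod_cast k.pos

/-- Since `k² q_k` is largest at `k = 1`, the bound on `b` keeps all arguments of the Lambert
function in its domain. -/
lemma Regime.weight_le (h : Regime d β α a b) (k : ℕ+) :
    b * β * (k : ℝ) ^ 2 * q d β α k ≤ Real.exp (-1) := by
  have hβ := h.beta_pos
  have hb := h.b_pos
  have hk := one_le_pnat k
  have hk0 := pnat_pos k
  have hd : (3 : ℝ) ≤ d := by exact_mod_cast h.three_le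
  have hA : 0 < (4 * Real.pi * β) ^ ((d : ℝ) / 2) := by
    have := Real.pi_pos
    positivity
  have h1 : (k : ℝ) ^ 2 * q d β α k ≤ q d β α 1 := by
    have hp : (k : ℝ) ^ 2 ≤ (k : ℝ) ^ (1 + (d : ℝ) / 2) := by
      rw [← Real.rpow_two]
      exact Real.rpow_le_rpow_of_exponent_le hk (by linarith)
    have he : Real.exp (β * (k : ℝ) * α) ≤ Real.exp (β * α) := by
      apply Real.exp_le_exp.2
      nlinarith [mul_nonneg hβ.le (mul_nonneg (sub_nonneg.2 hk) (neg_nonneg.2 h.alpha_nonpos))]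
    unfold q
    simp only [PNat.one_coe, Nat.cast_one, mul_one, Real.one_rpow]
    rw [mul_div_assoc', div_le_div_iff₀ (by positivity) hA]
    have := Real.exp_pos (β * α)
    calc (k : ℝ) ^ 2 * Real.exp (β * k * α) * (4 * Real.pi * β) ^ ((d : ℝ) / 2)
        ≤ (k : ℝ) ^ (1 + (d : ℝ) / 2) * Real.exp (β * α) * (4 * Real.pi * β) ^ ((d : ℝ) / 2) := by
          gcongr
      _ = _ := by ring
  have hq1 := h.q_pos 1
  have h2 : b * (Real.exp 1 * β * q d β α 1) ≤ 1 := by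
    have := h.b_le
    rwa [le_div_iff₀ (by positivity)] at this
  calc b * β * (k : ℝ) ^ 2 * q d β α k = b * β * ((k : ℝ) ^ 2 * q d β α k) := by ring
    _ ≤ b * β * q d β α 1 := by gcongr
    _ = b * (Real.exp 1 * β * q d β α 1) * Real.exp (-1) := by
        rw [Real.exp_neg]; field_simp
    _ ≤ 1 * Real.exp (-1) := by gcongr
    _ = _ := one_mul _

lemma Regime.summable_mul_q (h : Regime d β α a b) :
    Summable fun k : ℕ+ => (k : ℝ) * q d β α k := by
  have hβ := h.beta_pos
  have hd : (3 : ℝ) ≤ d := by exact_mod_cast h.three_le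
  have hA : 0 < (4 * Real.pi * β) ^ ((d : ℝ) / 2) := by
    have := Real.pi_pos
    positivity
  have hs : Summable fun k : ℕ+ =>
      1 / (4 * Real.pi * β) ^ ((d : ℝ) / 2) * ((k : ℝ) ^ (3 / 2 : ℝ))⁻¹ :=
    ((Real.summable_nat_rpow_inv.2 (by norm_num : (1 : ℝ) < 3 / 2)).comp_injective
      PNat.coe_injective).mul_left _
  refine Summable.of_nonneg_of_le (fun k => ?_) (fun k => ?_) hs
  · have := h.q_pos k
    positivity
  · have hk := one_le_pnat k
    have hk0 := pnat_pos k
    have he : Real.exp (β * (k : ℝ) * α) ≤ 1 := by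
      apply Real.exp_le_one_iff.2
      exact mul_nonpos_of_nonneg_of_nonpos (by positivity) h.alpha_nonpos
    have hp : (k : ℝ) ^ (3 / 2 : ℝ) ≤ (k : ℝ) ^ ((d : ℝ) / 2) :=
      Real.rpow_le_rpow_of_exponent_le hk (by linarith)
    unfold q
    rw [Real.rpow_add hk0, Real.rpow_one]
    calc (k : ℝ) * (Real.exp (β * k * α) /
          ((4 * Real.pi * β) ^ ((d : ℝ) / 2) * (k * (k : ℝ) ^ ((d : ℝ) / 2))))
        = Real.exp (β * k * α) * (1 / (4 * Real.pi * β) ^ ((d : ℝ) / 2) *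
            ((k : ℝ) ^ ((d : ℝ) / 2))⁻¹) := by field_simp
      _ ≤ 1 * (1 / (4 * Real.pi * β) ^ ((d : ℝ) / 2) * ((k : ℝ) ^ (3 / 2 : ℝ))⁻¹) := by
          gcongr
      _ = _ := one_mul _

lemma Regime.summable_q (h : Regime d β α a b) : Summable fun k : ℕ+ => q d β α k :=
  Summable.of_nonneg_of_le (fun k => (h.q_pos k).le)
    (fun k => le_mul_of_one_le_left (h.q_pos k).le (one_le_pnat k)) h.summable_mul_q

/-- The normalised occupation `b β k² x_k` of the cycles of length `k` at multiplier `l ≥ 0`: the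
solution `u ∈ (0, 1]` of `u exp (-u) = b β k² q_k exp (-β k l)`. -/
def cycleMass (d : ℕ) (β α b : ℝ) (k : ℕ+) (l : ℝ) : ℝ :=
  -lambertW0 (-(b * β * (k : ℝ) ^ 2 * q d β α k * Real.exp (-(β * k * l))))

section CycleMass

variable (h : Regime d β α a b) (k : ℕ+) {l : ℝ}
include h

lemma Regime.weight_pos : 0 < b * β * (k : ℝ) ^ 2 * q d β α k := by
  have := h.q_pos k
  have := h.b_pos
  have := h.beta_pos
  positivity

lemma Regime.cycleMass_spec (hl : 0 ≤ l) : 0 < cycleMass d β α b k l ∧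
    cycleMass d β α b k l ≤ 1 ∧ Real.log (cycleMass d β α b k l) - cycleMass d β α b k l =
      Real.log (b * β * (k : ℝ) ^ 2 * q d β α k) - β * k * l := by
  have hw := h.weight_pos k
  have hβ := h.beta_pos
  have he : Real.exp (-(β * k * l)) ≤ 1 := by
    rw [Real.exp_le_one_iff, neg_nonpos]; positivity
  have := lambertW0_spec (z := b * β * (k : ℝ) ^ 2 * q d β α k * Real.exp (-(β * k * l)))
    (by positivity) ((mul_le_of_le_one_right hw.le he).trans (h.weight_le k))
  rwa [Real.log_mul hw.ne' (Real.exp_pos _).ne', Real.log_exp, ← sub_eq_add_neg] at this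

lemma Regime.cycleMass_mem (hl : 0 ≤ l) : cycleMass d β α b k l ∈ Ioc 0 1 :=
  ⟨(h.cycleMass_spec k hl).1, (h.cycleMass_spec k hl).2.1⟩

lemma Regime.cycleMass_strictAntiOn : StrictAntiOn (cycleMass d β α b k) (Ici 0) := by
  intro x hx y hy hxy
  rw [← strictMonoOn_log_sub.lt_iff_lt (h.cycleMass_mem k hy) (h.cycleMass_mem k hx)]
  simp only [(h.cycleMass_spec k hx).2.2, (h.cycleMass_spec k hy).2.2]
  have : 0 < β * k := mul_pos h.beta_pos (pnat_pos k)
  linarith [mul_lt_mul_of_pos_left hxy this]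

lemma Regime.cycleMass_strictConvexOn : StrictConvexOn ℝ (Ici 0) (cycleMass d β α b k) := by
  refine ⟨convex_Ici 0, fun x hx y hy hne s t hs ht hst => ?_⟩
  have hz : s • x + t • y ∈ Ici (0 : ℝ) := convex_Ici 0 hx hy hs.le ht.le hst
  have hux := h.cycleMass_mem k hx
  have huy := h.cycleMass_mem k hy
  have huc := convex_Ioc (0 : ℝ) 1 hux huy hs.le ht.le hst
  rw [← strictMonoOn_log_sub.lt_iff_lt (h.cycleMass_mem k hz) huc]
  refine lt_of_eq_of_lt ?_ (strictConcaveOn_log_sub.2 hux huy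
    (fun he => hne ((h.cycleMass_strictAntiOn k).injOn hx hy he)) hs ht hst)
  beta_reduce
  rw [(h.cycleMass_spec k hz).2.2, (h.cycleMass_spec k hx).2.2, (h.cycleMass_spec k hy).2.2]
  simp only [smul_eq_mul]
  linear_combination (-Real.log (b * β * (k : ℝ) ^ 2 * q d β α k)) * hst

/-- Hölder continuity of order `1 / 2`; at the endpoint of the domain of the Lambert function no
more can be expected. -/
lemma Regime.cycleMass_sq_sub_le {x y : ℝ} (hx : 0 ≤ x) (hxy : x ≤ y) :
    (cycleMass d β α b k x - cycleMass d β α b k y) ^ 2 / 2 ≤ β * k * (y - x) := by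
  have hy := hx.trans hxy
  have := sq_le_log_sub (h.cycleMass_spec k hy).1
    ((h.cycleMass_strictAntiOn k).antitoneOn hx hy hxy) (h.cycleMass_spec k hx).2.1
  rw [(h.cycleMass_spec k hx).2.2, (h.cycleMass_spec k hy).2.2] at this
  linarith

lemma Regime.cycleMass_continuousOn : ContinuousOn (cycleMass d β α b k) (Ici 0) := by
  intro x hx
  have hb : ∀ y ∈ Ici (0 : ℝ), dist (cycleMass d β α b k y) (cycleMass d β α b k x) ≤
      Real.sqrt (2 * (β * k * |y - x|)) := by
    intro y hy
    rw [Real.dist_eq]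
    apply Real.abs_le_sqrt
    rcases le_total x y with hxy | hxy
    · have := h.cycleMass_sq_sub_le k hx hxy
      rw [abs_of_nonneg (sub_nonneg.2 hxy)]
      nlinarith
    · have := h.cycleMass_sq_sub_le k hy hxy
      rw [abs_of_nonpos (sub_nonpos.2 hxy)]
      nlinarith
  rw [ContinuousWithinAt, tendsto_iff_dist_tendsto_zero]
  refine squeeze_zero' (Eventually.of_forall fun _ => dist_nonneg)
    (eventually_nhdsWithin_of_forall hb) ?_
  have hc : Continuous fun y : ℝ => Real.sqrt (2 * (β * k * |y - x|)) := by fun_prop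
  have := hc.tendsto x
  simp only [sub_self, abs_zero, mul_zero, Real.sqrt_zero] at this
  exact this.mono_left nhdsWithin_le_nhds

lemma Regime.cycleMass_le (hl : 0 ≤ l) :
    cycleMass d β α b k l ≤ Real.exp 1 * (b * β * (k : ℝ) ^ 2 * q d β α k) := by
  obtain ⟨h0, h1, h2⟩ := h.cycleMass_spec k hl
  have hw := h.weight_pos k
  rw [← Real.log_le_log_iff h0 (by positivity), Real.log_mul (Real.exp_pos 1).ne' hw.ne',
    Real.log_exp]
  have : 0 ≤ β * k * l := mul_nonneg (mul_pos h.beta_pos (pnat_pos k)).le hl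
  linarith

end CycleMass

/-- The occupation numbers `ξ_k` of the critical point with Lagrange multiplier `l ≥ 0` for the
density constraint. -/
def profile (d : ℕ) (β α b : ℝ) (l : ℝ) (k : ℕ+) : ℝ :=
  cycleMass d β α b k l / (b * β * (k : ℝ) ^ 2)

/-- The density `N(l) = ∑_k k ξ_k` of the profile with multiplier `l`. -/
def gasDensity (d : ℕ) (β α b : ℝ) (l : ℝ) : ℝ := ∑' k : ℕ+, (k : ℝ) * profile d β α b l k

section Profile

variable (h : Regime d β α a b) {l : ℝ}
include h

lemma Regime.coef_pos (k : ℕ+) : 0 < b * β * (k : ℝ) ^ 2 := by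
  have := h.b_pos
  have := h.beta_pos
  positivity

lemma Regime.profile_pos (hl : 0 ≤ l) (k : ℕ+) : 0 < profile d β α b l k :=
  div_pos (h.cycleMass_spec k hl).1 (h.coef_pos k)

lemma Regime.profile_le (hl : 0 ≤ l) (k : ℕ+) :
    profile d β α b l k ≤ Real.exp 1 * q d β α k := by
  rw [profile, div_le_iff₀ (h.coef_pos k)]
  linarith [h.cycleMass_le k hl]

lemma Regime.summable_bound :
    Summable fun k : ℕ+ => (k : ℝ) * (Real.exp 1 * q d β α k) :=
  (h.summable_mul_q.mul_left (Real.exp 1)).congr fun k => by ring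

lemma Regime.summable_profile (hl : 0 ≤ l) :
    Summable fun k : ℕ+ => (k : ℝ) * profile d β α b l k :=
  Summable.of_nonneg_of_le
    (fun k => mul_nonneg (pnat_pos k).le (h.profile_pos hl k).le)
    (fun k => mul_le_mul_of_nonneg_left (h.profile_le hl k) (pnat_pos k).le) h.summable_bound

lemma Regime.gasDensity_pos (hl : 0 ≤ l) : 0 < gasDensity d β α b l :=
  (h.summable_profile hl).tsum_pos
    (fun k => mul_nonneg (pnat_pos k).le (h.profile_pos hl k).le) 1
    (mul_pos (pnat_pos 1) (h.profile_pos hl 1))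

lemma Regime.gasDensity_continuousOn : ContinuousOn (gasDensity d β α b) (Ici 0) := by
  refine continuousOn_tsum (fun k => ?_) h.summable_bound (fun k l hl => ?_)
  · exact continuousOn_const.mul ((h.cycleMass_continuousOn k).div_const _)
  · rw [Real.norm_of_nonneg (mul_nonneg (pnat_pos k).le (h.profile_pos hl k).le)]
    exact mul_le_mul_of_nonneg_left (h.profile_le hl k) (pnat_pos k).le

lemma Regime.gasDensity_strictAntiOn : StrictAntiOn (gasDensity d β α b) (Ici 0) := by
  intro x hx y hy hxy
  have hlt : ∀ k : ℕ+, (k : ℝ) * profile d β α b y k < k * profile d β α b x k := fun k =>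
    mul_lt_mul_of_pos_left
      (div_lt_div_of_pos_right (h.cycleMass_strictAntiOn k hx hy hxy) (h.coef_pos k)) (pnat_pos k)
  exact (h.summable_profile hy).tsum_lt_tsum (fun k => (hlt k).le) (hlt 1) (h.summable_profile hx)

lemma Regime.gasDensity_strictConvexOn : StrictConvexOn ℝ (Ici 0) (gasDensity d β α b) := by
  refine ⟨convex_Ici 0, fun x hx y hy hne s t hs ht hst => ?_⟩
  have hz : s • x + t • y ∈ Ici (0 : ℝ) := convex_Ici 0 hx hy hs.le ht.le hst
  have hsx := (h.summable_profile hx).mul_left s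
  have hsy := (h.summable_profile hy).mul_left t
  have hlt : ∀ k : ℕ+, (k : ℝ) * profile d β α b (s • x + t • y) k <
      s * (k * profile d β α b x k) + t * (k * profile d β α b y k) := by
    intro k
    have hc := (h.cycleMass_strictConvexOn k).2 hx hy hne hs ht hst
    have hck : 0 < (k : ℝ) / (b * β * (k : ℝ) ^ 2) := div_pos (pnat_pos k) (h.coef_pos k)
    have := mul_lt_mul_of_pos_left hc hck
    simp only [smul_eq_mul] at this
    simp only [profile, smul_eq_mul]
    exact lt_of_eq_of_lt (by ring) (this.trans_eq (by ring))
  have := (h.summable_profile hz).tsum_lt_tsum (fun k => (hlt k).le) (hlt 1) (hsx.add hsy)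
  rw [hsx.tsum_add hsy, tsum_mul_left, tsum_mul_left] at this
  exact this

end Profile

/-! ### The energy on the convex box -/

/-- The summand of the ideal gas rate function at cycle length `k`. -/
def rateTerm (d : ℕ) (β α : ℝ) (k : ℕ+) (t : ℝ) : ℝ :=
  (t * (Real.log (t / q d β α k) - 1) + q d β α k) / β

/-- The summand at cycle length `k` of the rate function with the counter term
`-(b / 2) k² x_k²` included. -/
def energyTerm (d : ℕ) (β α b : ℝ) (k : ℕ+) (t : ℝ) : ℝ :=
  rateTerm d β α k t - b / 2 * ((k : ℝ) ^ 2 * t ^ 2)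

/-- The box `0 ≤ x_k ≤ e q_k`, on which every `energyTerm` is convex. -/
def InBox (d : ℕ) (β α : ℝ) (x : ℕ+ → ℝ) : Prop :=
  ∀ k, 0 ≤ x k ∧ x k ≤ Real.exp 1 * q d β α k

/-- The density of a real sequence. -/
def realDensity (x : ℕ+ → ℝ) : ℝ := ∑' k : ℕ+, (k : ℝ) * x k

/-- The total energy `∑_k energyTerm k x_k`. -/
def energy (d : ℕ) (β α b : ℝ) (x : ℕ+ → ℝ) : ℝ := ∑' k : ℕ+, energyTerm d β α b k (x k)

/-- The dual function `P(l)`, the minimum of `energy x + l * realDensity x` over the box. -/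
def pressure (d : ℕ) (β α b : ℝ) (l : ℝ) : ℝ :=
  energy d β α b (profile d β α b l) + l * gasDensity d β α b l

lemma summable_sq_of_nonneg {x : ℕ+ → ℝ} (hx : ∀ k, 0 ≤ x k)
    (hs : Summable fun k : ℕ+ => (k : ℝ) * x k) :
    Summable fun k : ℕ+ => (k : ℝ) ^ 2 * x k ^ 2 := by
  have h0 : ∀ k : ℕ+, 0 ≤ (k : ℝ) * x k := fun k => mul_nonneg (pnat_pos k).le (hx k)
  refine Summable.of_nonneg_of_le (fun k => by positivity) (fun k => ?_)
    (hs.mul_right (∑' j : ℕ+, (j : ℝ) * x j))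
  calc (k : ℝ) ^ 2 * x k ^ 2 = (k * x k) * (k * x k) := by ring
    _ ≤ (k * x k) * ∑' j : ℕ+, (j : ℝ) * x j :=
      mul_le_mul_of_nonneg_left (hs.le_tsum k fun j _ => h0 j) (h0 k)

section Box

variable (h : Regime d β α a b) {l : ℝ}
include h

lemma Regime.rateTerm_nonneg (k : ℕ+) {t : ℝ} (ht : 0 ≤ t) : 0 ≤ rateTerm d β α k t :=
  div_nonneg (rate_term_nonneg ht (h.q_pos k)) h.beta_pos.le

lemma Regime.rateTerm_le (k : ℕ+) {t : ℝ} (ht : 0 ≤ t) (ht1 : t ≤ Real.exp 1 * q d β α k) :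
    rateTerm d β α k t ≤ q d β α k / β := by
  have hq := h.q_pos k
  refine div_le_div_of_nonneg_right ?_ h.beta_pos.le
  rcases ht.eq_or_lt with rfl | ht
  · simp
  · have : Real.log (t / q d β α k) ≤ 1 := by
      rw [Real.log_le_iff_le_exp (by positivity), div_le_iff₀ hq]
      exact ht1
    nlinarith

lemma Regime.rateTerm_zero_lt (k : ℕ+) {t : ℝ} (ht : Real.exp 1 * q d β α k < t) :
    rateTerm d β α k 0 < rateTerm d β α k t := by
  have hq := h.q_pos k
  have ht0 : 0 < t := lt_trans (by positivity) ht
  have : 1 < Real.log (t / q d β α k) := by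
    rw [Real.lt_log_iff_exp_lt (by positivity), lt_div_iff₀ hq]
    exact ht
  refine div_lt_div_of_pos_right ?_ h.beta_pos
  nlinarith

lemma Regime.profile_inBox (hl : 0 ≤ l) : InBox d β α (profile d β α b l) :=
  fun k => ⟨(h.profile_pos hl k).le, h.profile_le hl k⟩

variable {x : ℕ+ → ℝ} (hx : InBox d β α x)
include hx

lemma Regime.summable_mul_of_inBox : Summable fun k : ℕ+ => (k : ℝ) * x k :=
  Summable.of_nonneg_of_le (fun k => mul_nonneg (pnat_pos k).le (hx k).1)
    (fun k => mul_le_mul_of_nonneg_left (hx k).2 (pnat_pos k).le) h.summable_bound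

lemma Regime.summable_rateTerm_of_inBox : Summable fun k : ℕ+ => rateTerm d β α k (x k) :=
  Summable.of_nonneg_of_le (fun k => h.rateTerm_nonneg k (hx k).1)
    (fun k => h.rateTerm_le k (hx k).1 (hx k).2) (h.summable_q.div_const β)

lemma Regime.summable_energyTerm_of_inBox :
    Summable fun k : ℕ+ => energyTerm d β α b k (x k) :=
  (h.summable_rateTerm_of_inBox hx).sub
    ((summable_sq_of_nonneg (fun k => (hx k).1) (h.summable_mul_of_inBox hx)).mul_left (b / 2))

omit hx in
/-- The profile minimises the Lagrangian coordinate by coordinate; the entropy gained beats the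
counter term because `b β k² t ≤ 1` on the box. -/
lemma Regime.energyTerm_profile_lt (hl : 0 ≤ l) (k : ℕ+) {t : ℝ} (ht : 0 ≤ t)
    (ht1 : t ≤ Real.exp 1 * q d β α k) (hne : t ≠ profile d β α b l k) :
    energyTerm d β α b k (profile d β α b l k) + l * (k * profile d β α b l k) <
      energyTerm d β α b k t + l * (k * t) := by
  have hβ := h.beta_pos
  have hq := h.q_pos k
  have hc := h.coef_pos k
  have hξ := h.profile_pos hl k
  obtain ⟨hu0, hu1, hu⟩ := h.cycleMass_spec k hl
  set u := cycleMass d β α b k l with hu_def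
  set ξ := profile d β α b l k with hξ_def
  set c := b * β * (k : ℝ) ^ 2 with hc_def
  have huξ : u = c * ξ := by rw [hξ_def, profile, ← hu_def, ← hc_def]; field_simp
  have hct1 : c * t ≤ 1 := by
    have hw := h.weight_le k
    calc c * t ≤ c * (Real.exp 1 * q d β α k) := by gcongr
      _ = Real.exp 1 * (c * q d β α k) := by ring
      _ ≤ Real.exp 1 * Real.exp (-1) := by gcongr
      _ = 1 := by rw [← Real.exp_add]; simp
  have hent := sq_lt_entropy (mul_nonneg hc.le ht) hct1 hu0 hu1
    (fun he => hne (mul_left_cancel₀ hc.ne' (he.trans huξ)))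
  rw [huξ, mul_div_mul_left _ _ hc.ne'] at hent
  have hent' : c * (t - ξ) ^ 2 / 2 < t * Real.log (t / ξ) - t + ξ := by
    have : c * (c * (t - ξ) ^ 2 / 2) < c * (t * Real.log (t / ξ) - t + ξ) := by nlinarith
    exact lt_of_mul_lt_mul_left this hc.le
  have hlogξ : Real.log (ξ / q d β α k) = c * ξ - β * k * l := by
    rw [huξ, Real.log_mul hc.ne' hξ.ne', Real.log_mul hc.ne' hq.ne'] at hu
    rw [Real.log_div hξ.ne' hq.ne']
    linarith
  have hlogt : t * Real.log (t / q d β α k) =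
      t * Real.log (t / ξ) + t * (c * ξ - β * k * l) := by
    rcases ht.eq_or_lt with rfl | ht
    · simp
    · rw [← hlogξ, Real.log_div ht.ne' hq.ne', Real.log_div ht.ne' hξ.ne',
        Real.log_div hξ.ne' hq.ne']
      ring
  have hsub : (energyTerm d β α b k t + l * (k * t)) - (energyTerm d β α b k ξ + l * (k * ξ)) =
      (t * Real.log (t / ξ) - t + ξ - c * (t - ξ) ^ 2 / 2) / β := by
    have e1 : t * (Real.log (t / q d β α k) - 1) =
      t * Real.log (t / ξ) + t * (c * ξ - β * k * l) - t := by rw [mul_sub, hlogt]; ring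
    unfold energyTerm rateTerm
    rw [e1, hlogξ, hc_def]
    field_simp
    ring
  have := div_pos (sub_pos.2 hent') hβ
  rw [← hsub] at this
  linarith

lemma Regime.pressure_le (hl : 0 ≤ l) :
    pressure d β α b l ≤ energy d β α b x + l * realDensity x ∧
      (x ≠ profile d β α b l → pressure d β α b l < energy d β α b x + l * realDensity x) := by
  have hp := h.profile_inBox hl
  have hs1 := (h.summable_energyTerm_of_inBox hp).add ((h.summable_profile hl).mul_left l)
  have hs2 := (h.summable_energyTerm_of_inBox hx).add ((h.summable_mul_of_inBox hx).mul_left l)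
  have e1 : pressure d β α b l = ∑' k : ℕ+, (energyTerm d β α b k (profile d β α b l k) +
      l * (k * profile d β α b l k)) := by
    rw [(h.summable_energyTerm_of_inBox hp).tsum_add ((h.summable_profile hl).mul_left l),
      tsum_mul_left]
    rfl
  have e2 : energy d β α b x + l * realDensity x =
      ∑' k : ℕ+, (energyTerm d β α b k (x k) + l * (k * x k)) := by
    rw [(h.summable_energyTerm_of_inBox hx).tsum_add ((h.summable_mul_of_inBox hx).mul_left l),
      tsum_mul_left]
    rfl
  have hle : ∀ k : ℕ+, energyTerm d β α b k (profile d β α b l k) +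
      l * (k * profile d β α b l k) ≤ energyTerm d β α b k (x k) + l * (k * x k) := by
    intro k
    by_cases he : x k = profile d β α b l k
    · rw [he]
    · exact (h.energyTerm_profile_lt hl k (hx k).1 (hx k).2 he).le
  rw [e1, e2]
  refine ⟨hs1.tsum_le_tsum hle hs2, fun hne => ?_⟩
  obtain ⟨k, hk⟩ := Function.ne_iff.1 hne
  exact hs1.tsum_lt_tsum hle (h.energyTerm_profile_lt hl k (hx k).1 (hx k).2 hk) hs2

omit hx in
/-- The density is a supergradient of the dual function. -/
lemma Regime.pressure_le_add {l l' : ℝ} (hl : 0 ≤ l) (hl' : 0 ≤ l') :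
    pressure d β α b l' ≤ pressure d β α b l + (l' - l) * gasDensity d β α b l := by
  have := (h.pressure_le (h.profile_inBox hl) hl').1
  have e : realDensity (profile d β α b l) = gasDensity d β α b l := rfl
  rw [e] at this
  unfold pressure at this ⊢
  linarith

end Box

/-! ### The functional on sequences -/

/-- The density part of the functional after completing the square,
`-μ t + (a / 2) t² - (μ - a t)₊² / (2 (a - b)) + μ² / (2 a)`: it is convex for `t ≥ μ / a` and
concave for `t ≤ μ / a`. -/
def densityCost (a b μ t : ℝ) : ℝ :=
  if μ ≤ a * t then (a * t - μ) ^ 2 / (2 * a) else -(b * (a * t - μ) ^ 2 / (2 * a * (a - b)))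

/-- The functional `F_μ + μ² / (2 a)` on real sequences; it is meaningful where the series for the
density and the rate function converge. -/
def shiftedF (d : ℕ) (β α a b μ : ℝ) (x : ℕ+ → ℝ) : ℝ :=
  energy d β α b x + densityCost a b μ (realDensity x)

lemma densityCost_eq (hb : 0 < b) (hba : b < a) (μ t : ℝ) :
    densityCost a b μ t - μ ^ 2 / (2 * a) =
      -μ * t + a / 2 * t ^ 2 - (max (μ - a * t) 0) ^ 2 / (2 * (a - b)) := by
  have ha : 0 < a := hb.trans hba
  have hab : a - b ≠ 0 := (sub_pos.2 hba).ne'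
  unfold densityCost
  split_ifs with hμ
  · rw [max_eq_right (by linarith)]
    field_simp
    ring
  · rw [max_eq_left (by linarith)]
    field_simp
    ring

/-- Sending an amount `p` of density to infinitely long cycles is at least as good as keeping it in
one cycle length, up to the entropy. -/
lemma densityCost_sub_le (hb : 0 < b) (hba : b < a) (μ t : ℝ) {p : ℝ} (hp : 0 ≤ p) :
    densityCost a b μ (t - p) ≤ densityCost a b μ t - b / 2 * p ^ 2 := by
  have ha : 0 < a := hb.trans hba
  have hab : 0 < a - b := sub_pos.2 hba
  unfold densityCost
  split_ifs with h1 h2 h2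
  · have h3 : (a * t - μ) ^ 2 / (2 * a) - b / 2 * p ^ 2 - (a * (t - p) - μ) ^ 2 / (2 * a) =
        p * (a * (t - p) - μ) + (a - b) / 2 * p ^ 2 := by
      field_simp
      ring
    have h4 : 0 ≤ p * (a * (t - p) - μ) := mul_nonneg hp (by linarith)
    have h5 : 0 ≤ (a - b) / 2 * p ^ 2 := by positivity
    linarith
  · nlinarith [mul_nonneg ha.le hp]
  · have h3 : (a * t - μ) ^ 2 / (2 * a) - b / 2 * p ^ 2 +
        b * (a * (t - p) - μ) ^ 2 / (2 * a * (a - b)) =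
        ((a * t - μ) - b * p) ^ 2 / (2 * (a - b)) := by
      field_simp
      ring
    have h4 : 0 ≤ ((a * t - μ) - b * p) ^ 2 / (2 * (a - b)) := by positivity
    linarith
  · have h3 : -(b * (a * t - μ) ^ 2 / (2 * a * (a - b))) - b / 2 * p ^ 2 +
        b * (a * (t - p) - μ) ^ 2 / (2 * a * (a - b)) =
        b / (a - b) * (p * (μ - a * t)) + b ^ 2 / (2 * (a - b)) * p ^ 2 := by
      field_simp
      ring
    have h4 : 0 ≤ b / (a - b) * (p * (μ - a * t)) := by
      have : 0 ≤ μ - a * t := by linarith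
      positivity
    have h5 : 0 ≤ b ^ 2 / (2 * (a - b)) * p ^ 2 := by positivity
    linarith

lemma tsum_sq_le {x : ℕ+ → ℝ} (hx : ∀ k, 0 ≤ x k)
    (hs : Summable fun k : ℕ+ => (k : ℝ) * x k) :
    ∑' k : ℕ+, (k : ℝ) ^ 2 * x k ^ 2 ≤ realDensity x ^ 2 := by
  have h0 : ∀ k : ℕ+, 0 ≤ (k : ℝ) * x k := fun k => mul_nonneg (pnat_pos k).le (hx k)
  rw [sq (realDensity x)]
  nth_rewrite 1 [realDensity]
  rw [← tsum_mul_right]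
  refine (summable_sq_of_nonneg hx hs).tsum_le_tsum (fun k => ?_) (hs.mul_right _)
  calc (k : ℝ) ^ 2 * x k ^ 2 = (k * x k) * (k * x k) := by ring
    _ ≤ (k * x k) * realDensity x :=
      mul_le_mul_of_nonneg_left (hs.le_tsum k fun j _ => h0 j) (h0 k)

open Classical in
/-- The sequence with all occupation numbers above `e q_k` removed. -/
def truncate (d : ℕ) (β α : ℝ) (x : ℕ+ → ℝ) (k : ℕ+) : ℝ :=
  if x k ≤ Real.exp 1 * q d β α k then x k else 0

section Functional

variable (h : Regime d β α a b)
include h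

lemma Regime.truncate_inBox {x : ℕ+ → ℝ} (hx : ∀ k, 0 ≤ x k) :
    InBox d β α (truncate d β α x) := by
  intro k
  have := h.q_pos k
  unfold truncate
  split_ifs with hk
  · exact ⟨hx k, hk⟩
  · exact ⟨le_rfl, by positivity⟩

/-- Truncation to the box lowers the functional: the removed density can be placed on infinitely
long cycles, where it costs no entropy. -/
lemma Regime.shiftedF_truncate_le (μ : ℝ) {x : ℕ+ → ℝ} (hx : ∀ k, 0 ≤ x k)
    (hs : Summable fun k : ℕ+ => (k : ℝ) * x k)
    (hr : Summable fun k : ℕ+ => rateTerm d β α k (x k)) :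
    shiftedF d β α a b μ (truncate d β α x) ≤ shiftedF d β α a b μ x ∧
      (truncate d β α x ≠ x →
        shiftedF d β α a b μ (truncate d β α x) < shiftedF d β α a b μ x) := by
  set y := truncate d β α x with hy
  have hyb : InBox d β α y := h.truncate_inBox hx
  have hsy := h.summable_mul_of_inBox hyb
  have hg : ∀ k, 0 ≤ x k - y k := by
    intro k
    simp only [hy, truncate]
    split_ifs
    · simp
    · simpa using hx k
  have hsg : Summable fun k : ℕ+ => (k : ℝ) * (x k - y k) :=
    (hs.sub hsy).congr fun k => by ring
  set p := realDensity fun k => x k - y k with hp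
  have hp0 : 0 ≤ p := tsum_nonneg fun k => mul_nonneg (pnat_pos k).le (hg k)
  have hD : realDensity y = realDensity x - p := by
    have : p = realDensity x - realDensity y := by
      rw [hp, realDensity, realDensity, realDensity, ← hs.tsum_sub hsy]
      exact tsum_congr fun k => by ring
    linarith
  have hsq := summable_sq_of_nonneg hg hsg
  have hterm : ∀ k, energyTerm d β α b k (y k) ≤ energyTerm d β α b k (x k) +
      b / 2 * ((k : ℝ) ^ 2 * (x k - y k) ^ 2) ∧ (y k ≠ x k → energyTerm d β α b k (y k) <
        energyTerm d β α b k (x k) + b / 2 * ((k : ℝ) ^ 2 * (x k - y k) ^ 2)) := by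
    intro k
    by_cases hk : x k ≤ Real.exp 1 * q d β α k
    · have : y k = x k := by simp [hy, truncate, hk]
      simp [this]
    · have hyk : y k = 0 := by simp [hy, truncate, hk]
      have := h.rateTerm_zero_lt k (not_le.1 hk)
      rw [hyk]
      unfold energyTerm
      constructor <;> intros <;> linarith
  have hsx : Summable fun k : ℕ+ => energyTerm d β α b k (x k) :=
    hr.sub ((summable_sq_of_nonneg hx hs).mul_left (b / 2))
  have hsum := hsx.add (hsq.mul_left (b / 2))
  have hE : ∑' k : ℕ+, (energyTerm d β α b k (x k) + b / 2 * ((k : ℝ) ^ 2 * (x k - y k) ^ 2)) =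
      energy d β α b x + b / 2 * ∑' k : ℕ+, (k : ℝ) ^ 2 * (x k - y k) ^ 2 := by
    rw [hsx.tsum_add (hsq.mul_left (b / 2)), tsum_mul_left]
    rfl
  have hsqle : b / 2 * ∑' k : ℕ+, (k : ℝ) ^ 2 * (x k - y k) ^ 2 ≤ b / 2 * p ^ 2 :=
    mul_le_mul_of_nonneg_left (tsum_sq_le hg hsg) (by have := h.b_pos; positivity)
  have hcost := densityCost_sub_le h.b_pos h.b_lt μ (realDensity x) hp0
  unfold shiftedF
  rw [hD]
  constructor
  · have := (h.summable_energyTerm_of_inBox hyb).tsum_le_tsum (fun k => (hterm k).1) hsum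
    rw [hE] at this
    have e : energy d β α b y = ∑' k : ℕ+, energyTerm d β α b k (y k) := rfl
    linarith
  · intro hne
    obtain ⟨k, hk⟩ := Function.ne_iff.1 hne
    have := (h.summable_energyTerm_of_inBox hyb).tsum_lt_tsum (fun k => (hterm k).1)
      ((hterm k).2 hk) hsum
    rw [hE] at this
    have e : energy d β α b y = ∑' k : ℕ+, energyTerm d β α b k (y k) := rfl
    linarith

end Functional

/-! ### The extended-valued functional -/

lemma tsum_ofReal_eq_top {f : ℕ+ → ℝ} (hf : ∀ k, 0 ≤ f k) (hs : ¬ Summable f) :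
    ∑' k, ENNReal.ofReal (f k) = ⊤ := by
  by_contra hne
  refine hs ((ENNReal.summable_toReal hne).congr fun k => ?_)
  rw [ENNReal.toReal_ofReal (hf k)]

lemma density_eq_ofReal {x : Ell1Plus} (hs : Summable fun k : ℕ+ => (k : ℝ) * x.1 k) :
    density x = ENNReal.ofReal (realDensity x.1) :=
  (ENNReal.ofReal_tsum_of_nonneg (fun k => mul_nonneg (pnat_pos k).le (x.2 k)) hs).symm

lemma realDensity_nonneg {x : Ell1Plus} : 0 ≤ realDensity x.1 :=
  tsum_nonneg fun k => mul_nonneg (pnat_pos k).le (x.2 k)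

lemma Regime.F_eq (h : Regime d β α a b) (μ : ℝ) {x : Ell1Plus}
    (hs : Summable fun k : ℕ+ => (k : ℝ) * x.1 k)
    (hr : Summable fun k : ℕ+ => rateTerm d β α k (x.1 k)) :
    F d β α a b μ x = ((shiftedF d β α a b μ x.1 - μ ^ 2 / (2 * a) : ℝ) : EReal) := by
  have hD := density_eq_ofReal hs
  have hDt : density x ≠ ⊤ := by rw [hD]; exact ENNReal.ofReal_ne_top
  have hDr : (density x).toReal = realDensity x.1 := by
    rw [hD, ENNReal.toReal_ofReal realDensity_nonneg]
  have hR0 : ∀ k : ℕ+, 0 ≤ rateTerm d β α k (x.1 k) := fun k => h.rateTerm_nonneg k (x.2 k)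
  have hR : rate d β α x = ENNReal.ofReal (∑' k : ℕ+, rateTerm d β α k (x.1 k)) :=
    (ENNReal.ofReal_tsum_of_nonneg hR0 hr).symm
  have hsq := summable_sq_of_nonneg x.2 hs
  have hE : energy d β α b x.1 = ∑' k : ℕ+, rateTerm d β α k (x.1 k) -
      b / 2 * ∑' k : ℕ+, (k : ℝ) ^ 2 * x.1 k ^ 2 := by
    rw [← tsum_mul_left, ← hr.tsum_sub (hsq.mul_left (b / 2))]
    rfl
  unfold F hamLsc ham
  rw [if_neg hDt, if_neg hDt, hR, EReal.coe_ennreal_ofReal, max_eq_left (tsum_nonneg hR0), hDr,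
    ← EReal.coe_sub, ← EReal.coe_add, EReal.coe_eq_coe_iff]
  have := densityCost_eq h.b_pos h.b_lt μ (realDensity x.1)
  unfold shiftedF
  rw [hE]
  linarith

lemma Regime.F_eq_top (h : Regime d β α a b) (μ : ℝ) {x : Ell1Plus}
    (hx : ¬ ((Summable fun k : ℕ+ => (k : ℝ) * x.1 k) ∧
      Summable fun k : ℕ+ => rateTerm d β α k (x.1 k))) :
    F d β α a b μ x = ⊤ := by
  unfold F
  by_cases hs : Summable fun k : ℕ+ => (k : ℝ) * x.1 k
  · have hR : rate d β α x = ⊤ :=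
      tsum_ofReal_eq_top (fun k => h.rateTerm_nonneg k (x.2 k)) fun hr => hx ⟨hs, hr⟩
    have hDt : density x ≠ ⊤ := by rw [density_eq_ofReal hs]; exact ENNReal.ofReal_ne_top
    unfold hamLsc ham
    rw [if_neg hDt, if_neg hDt, hR, ← EReal.coe_sub, EReal.coe_ennreal_top]
    exact EReal.top_add_coe _
  · have hD : density x = ⊤ :=
      tsum_ofReal_eq_top (fun k => mul_nonneg (pnat_pos k).le (x.2 k)) hs
    unfold hamLsc
    rw [if_pos hD]
    exact EReal.add_top_of_ne_bot (EReal.coe_ennreal_ne_bot _)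

/-- A sequence in the box as an element of `ℓ₁(ℝ₊)`. -/
def Regime.ofBox (h : Regime d β α a b) {x : ℕ+ → ℝ} (hx : InBox d β α x) : Ell1Plus :=
  ⟨⟨x, by
    refine memℓp_gen ?_
    have : Summable x := Summable.of_nonneg_of_le (fun k => (hx k).1)
      (fun k => le_mul_of_one_le_left (hx k).1 (one_le_pnat k)) (h.summable_mul_of_inBox hx)
    refine this.congr fun k => ?_
    simp [abs_of_nonneg (hx k).1]⟩, fun k => (hx k).1⟩

lemma Regime.F_ofBox (h : Regime d β α a b) (μ : ℝ) {x : ℕ+ → ℝ} (hx : InBox d β α x) :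
    F d β α a b μ (h.ofBox hx) = ((shiftedF d β α a b μ x - μ ^ 2 / (2 * a) : ℝ) : EReal) :=
  h.F_eq μ (h.summable_mul_of_inBox hx) (h.summable_rateTerm_of_inBox hx)

lemma Regime.density_ofBox (h : Regime d β α a b) {x : ℕ+ → ℝ} (hx : InBox d β α x) :
    density (h.ofBox hx) = ENNReal.ofReal (realDensity x) :=
  density_eq_ofReal (x := h.ofBox hx) (h.summable_mul_of_inBox hx)

/-- A lower bound on the box is a lower bound everywhere, with the same cases of equality. -/
lemma Regime.le_F_of_box (h : Regime d β α a b) {μ v : ℝ} {s : Set (ℕ+ → ℝ)}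
    (hv : ∀ y, InBox d β α y → v ≤ shiftedF d β α a b μ y ∧ (shiftedF d β α a b μ y = v → y ∈ s))
    (x : Ell1Plus) : ((v - μ ^ 2 / (2 * a) : ℝ) : EReal) ≤ F d β α a b μ x ∧
      (F d β α a b μ x = ((v - μ ^ 2 / (2 * a) : ℝ) : EReal) → (x.1 : ℕ+ → ℝ) ∈ s) := by
  by_cases hx : (Summable fun k : ℕ+ => (k : ℝ) * x.1 k) ∧
      Summable fun k : ℕ+ => rateTerm d β α k (x.1 k)
  · rw [h.F_eq μ hx.1 hx.2, EReal.coe_le_coe_iff, EReal.coe_eq_coe_iff]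
    obtain ⟨h1, h2⟩ := hv _ (h.truncate_inBox x.2)
    obtain ⟨h3, h4⟩ := h.shiftedF_truncate_le μ x.2 hx.1 hx.2
    refine ⟨by linarith, fun he => ?_⟩
    by_cases hne : truncate d β α (x.1 : ℕ+ → ℝ) = x.1
    · rw [← hne]
      exact h2 (by linarith)
    · have := h4 hne
      linarith
  · rw [h.F_eq_top μ hx]
    exact ⟨le_top, fun he => absurd he.symm (EReal.coe_ne_top _)⟩

/-! ### Lower bounds on the box -/

/-- The coefficient `1 / b - 1 / a` of the linear term in `critPot`, the inverse of
`a b / (a - b)`. -/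
def slopeCoef (a b : ℝ) : ℝ := 1 / b - 1 / a

lemma Regime.slopeCoef_pos (h : Regime d β α a b) : 0 < slopeCoef a b :=
  sub_pos.2 (one_div_lt_one_div_of_lt h.b_pos h.b_lt)

lemma Regime.dualPair (h : Regime d β α a b) :
    DualPair (gasDensity d β α b) (pressure d β α b) where
  cont := h.gasDensity_continuousOn
  anti := h.gasDensity_strictAntiOn
  conv := h.gasDensity_strictConvexOn
  pos := fun _ hl => h.gasDensity_pos hl
  le_add := fun _ hl _ hl' => h.pressure_le_add hl hl'

section Bounds

variable (h : Regime d β α a b)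
include h

lemma Regime.gasObj_le_shiftedF {μ l : ℝ} (hl : 0 ≤ l) {x : ℕ+ → ℝ} (hx : InBox d β α x)
    (hμ : μ ≤ a * realDensity x) :
    gasObj (pressure d β α b) a μ l ≤ shiftedF d β α a b μ x ∧
      (shiftedF d β α a b μ x = gasObj (pressure d β α b) a μ l → x = profile d β α b l) := by
  have ha := h.a_pos
  have h1 : l * (realDensity x) - l * μ / a - l ^ 2 / (2 * a) ≤
      (a * realDensity x - μ) ^ 2 / (2 * a) := by
    have e : (a * realDensity x - μ) ^ 2 / (2 * a) -
        (l * (realDensity x) - l * μ / a - l ^ 2 / (2 * a)) =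
        (a * realDensity x - μ - l) ^ 2 / (2 * a) := by
      field_simp
      ring
    have : 0 ≤ (a * realDensity x - μ - l) ^ 2 / (2 * a) := by positivity
    linarith
  obtain ⟨h2, h3⟩ := h.pressure_le hx hl
  simp only [shiftedF, densityCost, if_pos hμ, gasObj]
  refine ⟨by linarith, fun he => ?_⟩
  by_contra hne
  have := h3 hne
  linarith

/-- Below the density `μ / a` the cost of the density is concave; it is bounded by its tangent at
the density of `x` itself, whose slope is `lam`. -/
lemma Regime.le_shiftedF_of_lt {μ l lam : ℝ} (hl : 0 ≤ l) {x : ℕ+ → ℝ} (hx : InBox d β α x)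
    (hμ : a * realDensity x < μ) (hlam : slopeCoef a b * lam = μ / a - realDensity x) :
    pressure d β α b l - l * μ / a + slopeCoef a b * l * lam - slopeCoef a b * lam ^ 2 / 2 ≤
        shiftedF d β α a b μ x ∧
      (shiftedF d β α a b μ x = pressure d β α b l - l * μ / a + slopeCoef a b * l * lam -
        slopeCoef a b * lam ^ 2 / 2 → x = profile d β α b l) := by
  have ha := h.a_pos
  have hb := h.b_pos
  have hab : a - b ≠ 0 := (sub_pos.2 h.b_lt).ne'
  have hD : realDensity x = μ / a - slopeCoef a b * lam := by linarith
  have hcost : b * (a * realDensity x - μ) ^ 2 / (2 * a * (a - b)) =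
      slopeCoef a b * lam ^ 2 / 2 := by
    rw [hD]
    unfold slopeCoef
    field_simp
    ring
  obtain ⟨h2, h3⟩ := h.pressure_le hx hl
  have hlD : l * realDensity x = l * μ / a - slopeCoef a b * l * lam := by rw [hD]; ring
  simp only [shiftedF, densityCost, if_neg (not_le.2 hμ), hcost]
  rw [hlD] at h2 h3
  refine ⟨by linarith, fun he => ?_⟩
  by_contra hne
  have := h3 hne
  linarith

lemma Regime.exists_lam {μ : ℝ} {x : ℕ+ → ℝ} (hμ : a * realDensity x < μ) :
    ∃ lam, 0 < lam ∧ slopeCoef a b * lam = μ / a - realDensity x := by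
  have hr := h.slopeCoef_pos
  have : 0 < μ / a - realDensity x := by
    rw [sub_pos, lt_div_iff₀ h.a_pos]
    linarith
  exact ⟨(μ / a - realDensity x) / slopeCoef a b, by positivity, by field_simp⟩

lemma Regime.condObj_le_shiftedF {μ lam : ℝ} (hl : 0 ≤ lam) {x : ℕ+ → ℝ} (hx : InBox d β α x)
    (hμ : a * realDensity x < μ) (hlam : slopeCoef a b * lam = μ / a - realDensity x) :
    condObj (pressure d β α b) a (slopeCoef a b) μ lam ≤ shiftedF d β α a b μ x ∧
      (shiftedF d β α a b μ x = condObj (pressure d β α b) a (slopeCoef a b) μ lam →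
        x = profile d β α b lam) := by
  have := h.le_shiftedF_of_lt hl hx hμ hlam
  have e : condObj (pressure d β α b) a (slopeCoef a b) μ lam =
      pressure d β α b lam - lam * μ / a + slopeCoef a b * lam * lam -
        slopeCoef a b * lam ^ 2 / 2 := by
    unfold condObj
    ring
  rwa [e]

variable {lt : ℝ} {lg lc : ℝ → ℝ}
  (B : Branches (gasDensity d β α b) a (slopeCoef a b) lt lg lc)
include B

/-- A box element is bounded below by the value of the gas branch, unless its density is below
`μ / a` with a multiplier larger than that of the gas branch. -/
lemma Regime.gas_bound_or {μ : ℝ} (hμ : μ < a * gasDensity d β α b 0) {x : ℕ+ → ℝ}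
    (hx : InBox d β α x) :
    (gasObj (pressure d β α b) a μ (lg μ) ≤ shiftedF d β α a b μ x ∧
      (shiftedF d β α a b μ x = gasObj (pressure d β α b) a μ (lg μ) →
        x = profile d β α b (lg μ))) ∨
    ∃ lam, lg μ < lam ∧
      condObj (pressure d β α b) a (slopeCoef a b) μ lam ≤ shiftedF d β α a b μ x ∧
      (shiftedF d β α a b μ x = condObj (pressure d β α b) a (slopeCoef a b) μ lam →
        x = profile d β α b lam) := by
  have hlg := B.gas_pos hμ
  have hr := h.slopeCoef_pos
  have ha := h.a_pos
  by_cases hD : μ ≤ a * realDensity x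
  · exact Or.inl (h.gasObj_le_shiftedF hlg.le hx hD)
  rw [not_le] at hD
  obtain ⟨lam, hlam0, hlam⟩ := h.exists_lam hD
  by_cases hle : lam ≤ lg μ
  · left
    have h1 := (h.le_shiftedF_of_lt hlg.le hx hD hlam).1
    have h2 : 0 < slopeCoef a b * lam * (lg μ - lam / 2) :=
      mul_pos (mul_pos hr hlam0) (by linarith)
    have h3 : 0 < (lg μ) ^ 2 / (2 * a) := by positivity
    have : gasObj (pressure d β α b) a μ (lg μ) < shiftedF d β α a b μ x := by
      unfold gasObj
      linarith
    exact ⟨this.le, fun he => absurd he this.ne'⟩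
  · exact Or.inr ⟨lam, not_le.1 hle, h.condObj_le_shiftedF hlam0.le hx hD hlam⟩

lemma Regime.gas_bound_of_le {μ : ℝ} (hμ : μ < a * gasDensity d β α b 0)
    (hμt : μ ≤ critPot (gasDensity d β α b) a (slopeCoef a b) lt) {x : ℕ+ → ℝ}
    (hx : InBox d β α x) :
    gasObj (pressure d β α b) a μ (lg μ) ≤ shiftedF d β α a b μ x ∧
      (shiftedF d β α a b μ x = gasObj (pressure d β α b) a μ (lg μ) →
        x = profile d β α b (lg μ)) := by
  rcases h.gas_bound_or B hμ hx with h1 | ⟨lam, h1, h2, -⟩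
  · exact h1
  · have hlg := B.gas_pos hμ
    have h3 := B.condObj_mono h.dualPair h.a_pos hμt hlg.le h1.le
    have h4 := (gasObj_le_condObj h.a_pos h.slopeCoef_pos (P := pressure d β α b) (μ := μ)
      (l := lg μ)).2 hlg
    have := h4.trans_le (h3.trans h2)
    exact ⟨this.le, fun he => absurd he this.ne'⟩

/-- Between the tangential potential and `m(0)` every box element is controlled by one of the two
branches. -/
lemma Regime.bound_or {μ : ℝ} (hμ : μ < a * gasDensity d β α b 0)
    (hμt : critPot (gasDensity d β α b) a (slopeCoef a b) lt < μ) {x : ℕ+ → ℝ}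
    (hx : InBox d β α x) :
    (gasObj (pressure d β α b) a μ (lg μ) ≤ shiftedF d β α a b μ x ∧
      (shiftedF d β α a b μ x = gasObj (pressure d β α b) a μ (lg μ) →
        x = profile d β α b (lg μ))) ∨
    (condObj (pressure d β α b) a (slopeCoef a b) μ (lc μ) ≤ shiftedF d β α a b μ x ∧
      (shiftedF d β α a b μ x = condObj (pressure d β α b) a (slopeCoef a b) μ (lc μ) →
        x = profile d β α b (lc μ))) := by
  rcases h.gas_bound_or B hμ hx with h1 | ⟨lam, h1, h2, h2'⟩
  · exact Or.inl h1
  have hlg := B.gas_pos hμ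
  have h4 := (gasObj_le_condObj h.a_pos h.slopeCoef_pos (P := pressure d β α b) (μ := μ)
    (l := lg μ)).2 hlg
  by_cases he : lam = lc μ
  · rw [he] at h2 h2'
    exact Or.inr ⟨h2, h2'⟩
  rcases le_total lt lam with hlt | hlt
  · have := (B.condObj_lt h.dualPair h.a_pos hμt.le hlt he).trans_le h2
    exact Or.inr ⟨this.le, fun he => absurd he this.ne'⟩
  · rcases B.condObj_le_or h.dualPair h.a_pos (μ := μ) hlg.le h1.le hlt with h5 | h5
    · have := h4.trans_le (h5.trans h2)
      exact Or.inl ⟨this.le, fun he => absurd he this.ne'⟩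
    · have hne : lt ≠ lc μ := by
        intro hE
        have := (B.cond μ hμt.le).2
        rw [← hE] at this
        exact hμt.ne this
      have := (B.condObj_lt h.dualPair h.a_pos hμt.le le_rfl hne).trans_le (h5.trans h2)
      exact Or.inr ⟨this.le, fun he => absurd he this.ne'⟩

lemma Regime.cond_bound_of_le (hlt : 0 < lt) {μ : ℝ} (hμ : a * gasDensity d β α b 0 ≤ μ)
    {x : ℕ+ → ℝ} (hx : InBox d β α x) :
    condObj (pressure d β α b) a (slopeCoef a b) μ (lc μ) ≤ shiftedF d β α a b μ x ∧
      (shiftedF d β α a b μ x = condObj (pressure d β α b) a (slopeCoef a b) μ (lc μ) →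
        x = profile d β α b (lc μ)) := by
  have hlt' : ∀ l, 0 ≤ l → l ≠ lc μ → _ := fun l hl hne =>
    B.condObj_lt_of_le h.dualPair h.a_pos hlt hμ hl hne
  have hm0 : critPot (gasDensity d β α b) a (slopeCoef a b) 0 = a * gasDensity d β α b 0 := by
    simp [critPot]
  have hlc : 0 < lc μ :=
    hlt.trans_le (B.cond μ ((B.min 0 le_rfl).trans (hm0.le.trans hμ))).1
  by_cases hD : μ ≤ a * realDensity x
  · have h1 := (h.gasObj_le_shiftedF le_rfl hx hD).1
    have h2 : gasObj (pressure d β α b) a μ 0 =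
        condObj (pressure d β α b) a (slopeCoef a b) μ 0 := by simp [gasObj, condObj]
    have := (hlt' 0 le_rfl hlc.ne).trans_le (h2.symm.le.trans h1)
    exact ⟨this.le, fun he => absurd he this.ne'⟩
  · rw [not_le] at hD
    obtain ⟨lam, hlam0, hlam⟩ := h.exists_lam hD
    have h1 := h.condObj_le_shiftedF hlam0.le hx hD hlam
    by_cases he : lam = lc μ
    · rwa [he] at h1
    · have := (hlt' lam hlam0.le he).trans_le h1.1
      exact ⟨this.le, fun he => absurd he this.ne'⟩

lemma Regime.shiftedF_gas {μ : ℝ} (hμ : μ ≤ a * gasDensity d β α b 0) :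
    shiftedF d β α a b μ (profile d β α b (lg μ)) = gasObj (pressure d β α b) a μ (lg μ) := by
  obtain ⟨h1, h2⟩ := B.gas μ hμ
  have ha := h.a_pos
  have e : realDensity (profile d β α b (lg μ)) = gasDensity d β α b (lg μ) := rfl
  have hN : gasDensity d β α b (lg μ) = (μ + lg μ) / a := by field_simp; linarith
  unfold shiftedF densityCost gasObj pressure
  rw [e, if_pos (by linarith), hN]
  field_simp
  ring

lemma Regime.shiftedF_cond (hlt : 0 < lt) {μ : ℝ}
    (hμ : critPot (gasDensity d β α b) a (slopeCoef a b) lt ≤ μ) :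
    a * gasDensity d β α b (lc μ) < μ ∧
    shiftedF d β α a b μ (profile d β α b (lc μ)) =
      condObj (pressure d β α b) a (slopeCoef a b) μ (lc μ) := by
  obtain ⟨h1, h2⟩ := B.cond μ hμ
  have ha := h.a_pos
  have hb := h.b_pos
  have hab : a - b ≠ 0 := (sub_pos.2 h.b_lt).ne'
  have hr := h.slopeCoef_pos
  have e : realDensity (profile d β α b (lc μ)) = gasDensity d β α b (lc μ) := rfl
  unfold critPot at h2
  have h3 : 0 < a * (slopeCoef a b * lc μ) := by
    have := hlt.trans_le h1
    positivity
  have h4 : a * gasDensity d β α b (lc μ) < μ := by linarith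
  refine ⟨h4, ?_⟩
  have hN : gasDensity d β α b (lc μ) = μ / a - slopeCoef a b * lc μ := by
    field_simp
    linarith
  unfold shiftedF densityCost condObj pressure
  rw [e, if_neg (not_le.2 h4), hN]
  unfold slopeCoef
  field_simp
  ring

end Bounds

/-! ### Slope of `h` at the origin -/

lemma Regime.hTilde_eq (h : Regime d β α a b) (x : ℝ) :
    hTilde d β α a b x = gasDensity d β α b (-(a * b / (a - b) * x)) := by
  unfold hTilde gasDensity profile cycleMass
  rw [← tsum_mul_left]
  refine tsum_congr fun k => ?_
  have := h.b_pos
  have := h.beta_pos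
  have := pnat_pos k
  rw [show -(β * (k : ℝ) * -(a * b / (a - b) * x)) = a * b / (a - b) * β * k * x by ring]
  field_simp

lemma Regime.kappa_pos (h : Regime d β α a b) : 0 < a * b / (a - b) :=
  div_pos (mul_pos h.a_pos h.b_pos) (sub_pos.2 h.b_lt)

lemma Regime.slopeCoef_mul_kappa (h : Regime d β α a b) (x : ℝ) :
    slopeCoef a b * (a * b / (a - b) * x) = x := by
  have := h.a_pos
  have := h.b_pos
  have hab : a - b ≠ 0 := (sub_pos.2 h.b_lt).ne'
  unfold slopeCoef
  field_simp

lemma Regime.muP_eq (h : Regime d β α a b) : muP d β α a b = a * gasDensity d β α b 0 := by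
  rw [muP, h.hTilde_eq]
  simp

lemma Regime.muTang_eq (h : Regime d β α a b) {lt : ℝ} {lg lc : ℝ → ℝ}
    (B : Branches (gasDensity d β α b) a (slopeCoef a b) lt lg lc) :
    muTang d β α a b = critPot (gasDensity d β α b) a (slopeCoef a b) lt := by
  have hκ := h.kappa_pos
  have hval : ∀ x, hTilde d β α a b x - x = gasDensity d β α b (-(a * b / (a - b) * x)) +
      slopeCoef a b * (-(a * b / (a - b) * x)) := by
    intro x
    rw [h.hTilde_eq, mul_neg, h.slopeCoef_mul_kappa, ← sub_eq_add_neg]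
  have hleast : IsLeast ((fun x : ℝ => hTilde d β α a b x - x) '' Iic 0)
      (gasDensity d β α b lt + slopeCoef a b * lt) := by
    refine ⟨⟨-(lt / (a * b / (a - b))), ?_, ?_⟩, ?_⟩
    · exact neg_nonpos.2 (div_nonneg B.lt_nonneg hκ.le)
    · simp only [hval]
      rw [mul_neg, neg_neg, mul_div_cancel₀ lt hκ.ne']
    · rintro _ ⟨x, hx, rfl⟩
      simp only [hval]
      have := B.min (-(a * b / (a - b) * x))
        (neg_nonneg.2 (mul_nonpos_of_nonneg_of_nonpos hκ.le hx))
      exact le_of_mul_le_mul_left this h.a_pos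
  rw [muTang, hleast.csInf_eq, critPot]

/-- If the slope of `h` at `0` is above one, then `m` decreases initially. -/
lemma Regime.exists_lt_of_slope (h : Regime d β α a b) (hs : SlopeCondition d β α a b) :
    ∃ l, 0 ≤ l ∧ critPot (gasDensity d β α b) a (slopeCoef a b) l <
      critPot (gasDensity d β α b) a (slopeCoef a b) 0 := by
  have hκ := h.kappa_pos
  obtain ⟨L, hL, hL1⟩ := hs
  have hev : ∀ᶠ x in 𝓝[<] (0 : ℝ), 1 < deriv (hTilde d β α a b) x := by
    filter_upwards [hL.eventually (lt_mem_nhds hL1)] with x hx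
    exact_mod_cast hx
  obtain ⟨c, hc, hcs⟩ := (mem_nhdsLT_iff_exists_Ioo_subset).1 hev
  have hcont : ContinuousOn (hTilde d β α a b) (Icc c 0) := by
    have e : hTilde d β α a b = fun x => gasDensity d β α b (-(a * b / (a - b) * x)) :=
      funext h.hTilde_eq
    rw [e]
    refine h.gasDensity_continuousOn.comp (by fun_prop) fun x hx => ?_
    exact neg_nonneg.2 (mul_nonpos_of_nonneg_of_nonpos hκ.le hx.2)
  obtain ⟨x, hx, hslope⟩ := exists_deriv_eq_slope (hTilde d β α a b) hc hcont fun x hx =>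
    (differentiableAt_of_deriv_ne_zero
      (ne_of_gt (lt_trans one_pos (hcs hx)))).differentiableWithinAt
  have h1 : 1 < deriv (hTilde d β α a b) x := hcs hx
  have hc' : c < 0 := hc
  rw [hslope, lt_div_iff₀ (by linarith), h.hTilde_eq, h.hTilde_eq, mul_zero, neg_zero] at h1
  refine ⟨-(a * b / (a - b) * c),
    neg_nonneg.2 (mul_nonpos_of_nonneg_of_nonpos hκ.le hc'.le), ?_⟩
  unfold critPot
  refine mul_lt_mul_of_pos_left ?_ h.a_pos
  rw [mul_neg, h.slopeCoef_mul_kappa]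
  linarith

lemma not_summable_pnat_inv : ¬ Summable fun k : ℕ+ => (k : ℝ)⁻¹ := by
  intro hs
  refine Real.not_summable_natCast_inv ?_
  rw [← summable_nat_add_iff 1]
  exact hs.comp_injective (i := Nat.succPNat) Nat.succPNat_injective

/-- The drop of the occupation between the multipliers `0` and `l`. -/
lemma Regime.mul_le_profile_sub (h : Regime d β α a b) {l : ℝ} (hl : 0 ≤ l) (k : ℕ+) :
    l * (β * ((k : ℝ) ^ 2 * q d β α k)) * Real.exp (-(β * k * l)) ≤
      k * profile d β α b 0 k - k * profile d β α b l k := by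
  have hβ := h.beta_pos
  have hb := h.b_pos
  have hk := pnat_pos k
  have hw := h.weight_pos k
  obtain ⟨hu0, hu1, hu⟩ := h.cycleMass_spec k hl
  obtain ⟨hv0, hv1, hv⟩ := h.cycleMass_spec k (le_refl (0 : ℝ))
  have huv := (h.cycleMass_strictAntiOn k).antitoneOn self_mem_Ici hl hl
  set u := cycleMass d β α b k l with hu_def
  set v := cycleMass d β α b k 0 with hv_def
  set w := b * β * (k : ℝ) ^ 2 * q d β α k with hw_def
  set y := β * k * l with hy_def
  have hy : 0 ≤ y := by positivity
  have h1 : u * Real.exp y ≤ v := by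
    rw [← Real.log_le_log_iff (by positivity) hv0, Real.log_mul hu0.ne' (Real.exp_pos _).ne',
      Real.log_exp]
    linarith
  have h2 : w * Real.exp (-y) ≤ u := by
    rw [← Real.log_le_log_iff (by positivity) hu0, Real.log_mul hw.ne' (Real.exp_pos _).ne',
      Real.log_exp]
    linarith
  have h3 : y * (w * Real.exp (-y)) ≤ v - u := by
    have := mul_le_mul_of_nonneg_left (Real.add_one_le_exp y) hu0.le
    have := mul_le_mul_of_nonneg_left h2 hy
    linarith
  have h4 : (k : ℝ) * profile d β α b 0 k - k * profile d β α b l k = (v - u) / (b * β * k) := by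
    rw [profile, profile, ← hu_def, ← hv_def]
    field_simp
  rw [h4, le_div_iff₀ (by positivity)]
  refine le_trans (le_of_eq ?_) h3
  rw [hw_def, hy_def]
  ring

/-- For `d ≤ 4` and `α = 0` the harmonic series gives `h` an infinite slope at `0`. -/
lemma Regime.exists_lt_of_le_four (h : Regime d β α a b) (hd : d ≤ 4) (hα : α = 0) :
    ∃ l, 0 ≤ l ∧ critPot (gasDensity d β α b) a (slopeCoef a b) l <
      critPot (gasDensity d β α b) a (slopeCoef a b) 0 := by
  have hβ := h.beta_pos
  set A := (4 * Real.pi * β) ^ ((d : ℝ) / 2) with hA_def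
  have hA : 0 < A := by
    have := Real.pi_pos
    positivity
  have hq : ∀ k : ℕ+, (k : ℝ)⁻¹ / A ≤ (k : ℝ) ^ 2 * q d β α k := by
    intro k
    have hk := one_le_pnat k
    have hk0 := pnat_pos k
    have hd' : (d : ℝ) ≤ 4 := by exact_mod_cast hd
    have hp : (k : ℝ) ^ (1 + (d : ℝ) / 2) ≤ (k : ℝ) ^ 3 := by
      rw [← Real.rpow_natCast]
      exact Real.rpow_le_rpow_of_exponent_le hk (by push_cast; linarith)
    rw [q, hα, mul_zero, Real.exp_zero, ← hA_def, mul_one_div, inv_eq_one_div, div_div,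
      div_le_div_iff₀ (by positivity) (by positivity)]
    calc 1 * (A * (k : ℝ) ^ (1 + (d : ℝ) / 2)) ≤ 1 * (A * (k : ℝ) ^ 3) := by gcongr
      _ = (k : ℝ) ^ 2 * (k * A) := by ring
  obtain ⟨s, hs⟩ : ∃ s : Finset ℕ+,
      slopeCoef a b * Real.exp 1 * A / β < ∑ k ∈ s, (k : ℝ)⁻¹ := by
    by_contra! hcon
    exact not_summable_pnat_inv (summable_of_sum_le (fun k => by positivity) hcon)
  -- with this multiplier all exponential factors over `s` are at least `exp (-1)`
  set M : ℝ := 1 + ∑ k ∈ s, (k : ℝ) with hM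
  have hM0 : 0 < M := by
    have : 0 ≤ ∑ k ∈ s, (k : ℝ) := Finset.sum_nonneg fun k _ => (pnat_pos k).le
    linarith
  set l := 1 / (β * M) with hl_def
  have hl : 0 < l := by positivity
  have hterm : ∀ k ∈ s, l * β / A * Real.exp (-1) * (k : ℝ)⁻¹ ≤
      k * profile d β α b 0 k - k * profile d β α b l k := by
    intro k hk
    refine le_trans ?_ (h.mul_le_profile_sub hl.le k)
    have hkM : (k : ℝ) ≤ M := by
      have := Finset.single_le_sum (f := fun k : ℕ+ => (k : ℝ)) (fun k _ => (pnat_pos k).le) hk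
      linarith
    have he : Real.exp (-1) ≤ Real.exp (-(β * k * l)) := by
      apply Real.exp_le_exp.2
      have : β * k * l = k / M := by rw [hl_def]; field_simp
      rw [this, neg_le_neg_iff, div_le_one hM0]
      exact hkM
    calc l * β / A * Real.exp (-1) * (k : ℝ)⁻¹
        = l * (β * ((k : ℝ)⁻¹ / A)) * Real.exp (-1) := by ring
      _ ≤ l * (β * ((k : ℝ) ^ 2 * q d β α k)) * Real.exp (-(β * k * l)) := by
          have := hq k
          have := h.q_pos k
          gcongr
  have hs0 := h.summable_profile (le_refl (0 : ℝ))
  have hsl := h.summable_profile hl.le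
  have hsum : ∑ k ∈ s, ((k : ℝ) * profile d β α b 0 k - k * profile d β α b l k) ≤
      gasDensity d β α b 0 - gasDensity d β α b l := by
    rw [gasDensity, gasDensity, ← hs0.tsum_sub hsl]
    refine (hs0.sub hsl).sum_le_tsum s fun k _ => ?_
    refine le_trans ?_ (h.mul_le_profile_sub hl.le k)
    have := h.q_pos k
    positivity
  have h1 := (Finset.sum_le_sum hterm).trans hsum
  rw [← Finset.mul_sum] at h1
  have h2 : slopeCoef a b * l < l * β / A * Real.exp (-1) * ∑ k ∈ s, (k : ℝ)⁻¹ := by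
    have hpos : 0 < l * β / A * Real.exp (-1) := by positivity
    have := mul_lt_mul_of_pos_left hs hpos
    refine lt_of_eq_of_lt ?_ this
    rw [Real.exp_neg]
    field_simp
  refine ⟨l, hl.le, ?_⟩
  unfold critPot
  refine mul_lt_mul_of_pos_left ?_ h.a_pos
  linarith

/-! ### Minimisers and the phase transition -/

/-- The critical point with multiplier `l ≥ 0` as an element of `ℓ₁(ℝ₊)`. -/
def Regime.point (h : Regime d β α a b) {l : ℝ} (hl : 0 ≤ l) : Ell1Plus :=
  h.ofBox (h.profile_inBox hl)

lemma Regime.density_point (h : Regime d β α a b) {l : ℝ} (hl : 0 ≤ l) :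
    (density (h.point hl) : EReal) = (gasDensity d β α b l : EReal) := by
  rw [Regime.point, h.density_ofBox, EReal.coe_ennreal_ofReal]
  exact congrArg _ (max_eq_left (h.gasDensity_pos hl).le)

lemma Regime.eq_point (h : Regime d β α a b) {l : ℝ} (hl : 0 ≤ l) {x : Ell1Plus}
    (hx : (x.1 : ℕ+ → ℝ) = profile d β α b l) : x = h.point hl :=
  Subtype.ext (lp.ext hx)

/-- If the functional is bounded below on the box by a value that a profile attains, with equality
only at points of a set `S`, then that value is the infimum, and all minimisers lie in `S`. -/
lemma Regime.iInf_eq_of_box (h : Regime d β α a b) {μ v l : ℝ} (hl : 0 ≤ l) {s : Set (ℕ+ → ℝ)}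
    (hv : ∀ y, InBox d β α y → v ≤ shiftedF d β α a b μ y ∧ (shiftedF d β α a b μ y = v → y ∈ s))
    (hat : shiftedF d β α a b μ (profile d β α b l) = v) :
    ((v - μ ^ 2 / (2 * a) : ℝ) : EReal) = ⨅ x : Ell1Plus, F d β α a b μ x ∧
      h.point hl ∈ minimisers d β α a b μ ∧
      ∀ x ∈ minimisers d β α a b μ, (x.1 : ℕ+ → ℝ) ∈ s := by
  have hF : F d β α a b μ (h.point hl) = ((v - μ ^ 2 / (2 * a) : ℝ) : EReal) := by
    rw [Regime.point, h.F_ofBox, hat]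
  have hle := h.le_F_of_box hv
  refine ⟨le_antisymm (le_iInf fun x => (hle x).1) ((iInf_le _ (h.point hl)).trans hF.le),
    fun x => hF.le.trans (hle x).1, fun x hx => (hle x).2 (le_antisymm ?_ (hle x).1)⟩
  exact (hx (h.point hl)).trans hF.le

lemma Regime.minimisers_eq_singleton (h : Regime d β α a b) {μ v l : ℝ} (hl : 0 ≤ l)
    (hv : ∀ y, InBox d β α y → v ≤ shiftedF d β α a b μ y ∧
      (shiftedF d β α a b μ y = v → y = profile d β α b l))
    (hat : shiftedF d β α a b μ (profile d β α b l) = v) :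
    ((v - μ ^ 2 / (2 * a) : ℝ) : EReal) = ⨅ x : Ell1Plus, F d β α a b μ x ∧
      minimisers d β α a b μ = {h.point hl} := by
  obtain ⟨h1, h2, h3⟩ := h.iInf_eq_of_box hl (s := {profile d β α b l}) hv hat
  refine ⟨h1, Subset.antisymm (fun x hx => h.eq_point hl (h3 x hx)) ?_⟩
  rintro x rfl
  exact h2

/-- The conclusion in terms of the multipliers `lg < lc` of the two branches: below the crossing
the gas branch is the minimiser, above it the condensed branch. -/
lemma Regime.exists_transition (h : Regime d β α a b) {lt : ℝ} {lg lc : ℝ → ℝ}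
    (B : Branches (gasDensity d β α b) a (slopeCoef a b) lt lg lc) (hlt : 0 < lt) :
    ∃ μs ∈ Ioo (critPot (gasDensity d β α b) a (slopeCoef a b) lt) (a * gasDensity d β α b 0),
      (∀ μ : ℝ, μ ≠ μs → ∃ ξ : Ell1Plus, minimisers d β α a b μ = {ξ}) ∧
      (∃ ξ₁ ξ₂ : Ell1Plus, ξ₁ ≠ ξ₂ ∧ minimisers d β α a b μs = {ξ₁, ξ₂} ∧
        density ξ₁ ≠ ⊤ ∧
        ((μs / a : ℝ) : EReal) < (density ξ₁ : EReal) ∧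
        (density ξ₂ : EReal) < ((μs / a : ℝ) : EReal)) ∧
      (∃ f : ℝ → ℝ, (∀ μ : ℝ, (f μ : EReal) = ⨅ x : Ell1Plus, F d β α a b μ x) ∧
        DifferentiableOn ℝ f (Iio μs ∪ Ioi μs) ∧
        ∀ U : Set ℝ, IsOpen U → μs ∈ U → ¬ DifferentiableOn ℝ f U) := by
  have D := h.dualPair
  have ha := h.a_pos
  have hr := h.slopeCoef_pos
  obtain ⟨μs, ⟨hμt, hμp⟩, heq, hbelow, habove⟩ := B.exists_crossing D ha hr hlt
  set N := gasDensity d β α b with hN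
  set P := pressure d β α b with hP
  set r := slopeCoef a b with hr_def
  have hlg0 : ∀ μ ≤ a * N 0, 0 ≤ lg μ := fun μ hμ => (B.gas μ hμ).1
  have hlc0 : ∀ μ, critPot N a r lt ≤ μ → 0 ≤ lc μ := fun μ hμ =>
    hlt.le.trans (B.cond μ hμ).1
  have hgas : ∀ μ < μs, ∀ y, InBox d β α y → gasObj P a μ (lg μ) ≤ shiftedF d β α a b μ y ∧
      (shiftedF d β α a b μ y = gasObj P a μ (lg μ) → y = profile d β α b (lg μ)) := by
    intro μ hμ y hy
    rcases le_or_gt μ (critPot N a r lt) with hle | hgt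
    · exact h.gas_bound_of_le B (hμ.trans hμp) hle hy
    · rcases h.bound_or B (hμ.trans hμp) hgt hy with h1 | ⟨h1, -⟩
      · exact h1
      · have := (hbelow μ ⟨hgt.le, hμ⟩).trans_le h1
        exact ⟨this.le, fun he => absurd he this.ne'⟩
  have hcond : ∀ μ > μs, ∀ y, InBox d β α y → condObj P a r μ (lc μ) ≤ shiftedF d β α a b μ y ∧
      (shiftedF d β α a b μ y = condObj P a r μ (lc μ) → y = profile d β α b (lc μ)) := by
    intro μ hμ y hy
    rcases le_or_gt (a * N 0) μ with hle | hgt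
    · exact h.cond_bound_of_le B hlt hle hy
    · rcases h.bound_or B hgt (hμt.trans hμ) hy with ⟨h1, -⟩ | h1
      · have := (habove μ ⟨hμ, hgt.le⟩).trans_le h1
        exact ⟨this.le, fun he => absurd he this.ne'⟩
      · exact h1
  have hcrit : ∀ y, InBox d β α y → gasObj P a μs (lg μs) ≤ shiftedF d β α a b μs y ∧
      (shiftedF d β α a b μs y = gasObj P a μs (lg μs) →
        y ∈ ({profile d β α b (lg μs), profile d β α b (lc μs)} : Set (ℕ+ → ℝ))) := by
    intro y hy
    rcases h.bound_or B hμp hμt hy with ⟨h1, h2⟩ | ⟨h1, h2⟩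
    · exact ⟨h1, fun he => Or.inl (h2 he)⟩
    · rw [← hP, ← hr_def, ← heq] at h1 h2
      exact ⟨h1, fun he => Or.inr (h2 he)⟩
  have hgasMin := fun μ (hμ : μ < μs) =>
    h.minimisers_eq_singleton (hlg0 μ (hμ.trans hμp).le) (hgas μ hμ)
      (h.shiftedF_gas B (hμ.trans hμp).le)
  have hcondMin := fun μ (hμ : μs < μ) =>
    h.minimisers_eq_singleton (hlc0 μ (hμt.trans hμ).le) (hcond μ hμ)
      (h.shiftedF_cond B hlt (hμt.trans hμ).le).2
  have hcritG := h.iInf_eq_of_box (hlg0 μs hμp.le) hcrit (h.shiftedF_gas B hμp.le)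
  have hcritC := h.iInf_eq_of_box (hlc0 μs hμt.le) hcrit
    ((h.shiftedF_cond B hlt hμt.le).2.trans heq.symm)
  have hd1 : ((μs / a : ℝ) : EReal) < (density (h.point (hlg0 μs hμp.le)) : EReal) := by
    rw [h.density_point, EReal.coe_lt_coe_iff, div_lt_iff₀ ha]
    have := (B.gas μs hμp.le).2
    have := B.gas_pos hμp
    linarith
  have hd2 : (density (h.point (hlc0 μs hμt.le)) : EReal) < ((μs / a : ℝ) : EReal) := by
    rw [h.density_point, EReal.coe_lt_coe_iff, lt_div_iff₀ ha]
    have := (h.shiftedF_cond B hlt hμt.le).1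
    linarith
  refine ⟨μs, ⟨hμt, hμp⟩, fun μ hμ => ?_,
    ⟨h.point (hlg0 μs hμp.le), h.point (hlc0 μs hμt.le), ?_, ?_, ?_, hd1, hd2⟩, ?_⟩
  · rcases lt_or_gt_of_ne hμ with hlt' | hgt
    · exact ⟨_, (hgasMin μ hlt').2⟩
    · exact ⟨_, (hcondMin μ hgt).2⟩
  · intro he
    rw [he] at hd1
    exact absurd (hd1.trans hd2) (lt_irrefl _)
  · refine Subset.antisymm (fun x hx => ?_) ?_
    · rcases hcritG.2.2 x hx with hx | hx
      · exact Or.inl (h.eq_point _ hx)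
      · exact Or.inr (h.eq_point _ hx)
    · rintro x (rfl | rfl)
      · exact hcritG.2.1
      · exact hcritC.2.1
  · rw [Regime.point, h.density_ofBox]
    exact ENNReal.ofReal_ne_top
  -- the infimum follows the gas branch up to `μs` and the condensed branch from there on
  set vg : ℝ → ℝ := fun μ => gasObj P a μ (lg μ) - μ ^ 2 / (2 * a) with hvg
  set vc : ℝ → ℝ := fun μ => condObj P a r μ (lc μ) - μ ^ 2 / (2 * a) with hvc
  have hsq : ∀ μ : ℝ, HasDerivAt (fun μ : ℝ => μ ^ 2 / (2 * a)) (μ / a) μ := by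
    intro μ
    refine ((hasDerivAt_pow 2 μ).div_const (2 * a)).congr_deriv ?_
    field_simp
    norm_num
  have hdg : ∀ μ < a * N 0, HasDerivAt vg (-(lg μ / a) - μ / a) μ := fun μ hμ =>
    (B.gasValue_hasDerivAt D ha hμ).sub (hsq μ)
  have hdc : ∀ μ, critPot N a r lt < μ → HasDerivAt vc (-(lc μ / a) - μ / a) μ := fun μ hμ =>
    (B.condValue_hasDerivAt D ha hμ).sub (hsq μ)
  set f : ℝ → ℝ := fun μ => if μ ≤ μs then vg μ else vc μ with hf
  refine ⟨f, fun μ => ?_, ?_, ?_⟩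
  · rcases lt_trichotomy μ μs with h1 | rfl | h1
    · simp only [hf, if_pos h1.le]
      exact (hgasMin μ h1).1
    · simp only [hf, if_pos le_rfl]
      exact hcritG.1
    · simp only [hf, if_neg (not_le.2 h1)]
      exact (hcondMin μ h1).1
  · rintro μ (hμ | hμ)
    · refine ((hdg μ (lt_trans hμ hμp)).congr_of_eventuallyEq ?_).differentiableAt
        |>.differentiableWithinAt
      filter_upwards [Iio_mem_nhds hμ] with ν hν
      exact if_pos (le_of_lt hν)
    · refine ((hdc μ (lt_trans hμt hμ)).congr_of_eventuallyEq ?_).differentiableAt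
        |>.differentiableWithinAt
      filter_upwards [Ioi_mem_nhds hμ] with ν hν
      exact if_neg (not_le.2 hν)
  · -- a derivative at `μs` would have to equal the slopes of both branches, which touch `f` from
    -- above there
    intro U hU hμU hdiff
    have hdf := (hdiff.differentiableAt (hU.mem_nhds hμU)).hasDerivAt
    have hfs : f μs = vg μs := if_pos le_rfl
    have hvgc : vg μs = vc μs := by simp only [hvg, hvc, heq]
    have e1 : IsLocalMin (fun μ => vg μ - f μ) μs := by
      filter_upwards [Iio_mem_nhds hμp] with μ hμ
      rw [hfs, sub_self, sub_nonneg]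
      rcases le_or_gt μ μs with h1 | h1
      · exact (if_pos h1).le
      · simp only [hf, if_neg (not_le.2 h1), hvg, hvc]
        linarith [habove μ ⟨h1, le_of_lt hμ⟩]
    have e2 : IsLocalMin (fun μ => vc μ - f μ) μs := by
      filter_upwards [Ioi_mem_nhds hμt] with μ hμ
      rw [hfs, hvgc, sub_self, sub_nonneg]
      rcases lt_trichotomy μ μs with h1 | rfl | h1
      · simp only [hf, if_pos h1.le, hvg, hvc]
        linarith [hbelow μ ⟨le_of_lt hμ, h1⟩]
      · rw [hfs, hvgc]
      · exact (if_neg (not_le.2 h1)).le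
    have z1 := e1.hasDerivAt_eq_zero ((hdg μs hμp).sub hdf)
    have z2 := e2.hasDerivAt_eq_zero ((hdc μs hμt).sub hdf)
    have hne : lg μs / a < lc μs / a :=
      div_lt_div_of_pos_right (B.gas_lt_cond D ha hr hlt hμt.le hμp.le) ha
    linarith

end

end HYL

theorem mainTheorem1 (d : ℕ) (hd : 3 ≤ d) (β α a b : ℝ) (hβ : 0 < β) (hα : α ≤ 0)
    (ha : 0 < a) (hb : 0 < b) (hba : b < a)
    (hbstar : b ≤ 1 / (Real.exp 1 * β * HYL.q d β α 1))
    (hbp : b < (β * HYL.q d β α 1)⁻¹ * Real.exp (-β * HYL.muP d β α a b / a))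
    (hslope : (5 ≤ d ∨ α < 0) → HYL.SlopeCondition d β α a b) :
    ∃ μs ∈ Ioo (HYL.muTang d β α a b) (HYL.muP d β α a b),
      -- a unique minimiser for every other parameter
      (∀ μ : ℝ, μ ≠ μs → ∃ ξ : HYL.Ell1Plus, HYL.minimisers d β α a b μ = {ξ}) ∧
      -- exactly two minimisers at the critical parameter, on either side of `μs / a`
      (∃ ξ₁ ξ₂ : HYL.Ell1Plus, ξ₁ ≠ ξ₂ ∧ HYL.minimisers d β α a b μs = {ξ₁, ξ₂} ∧
        HYL.density ξ₁ ≠ ⊤ ∧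
        ((μs / a : ℝ) : EReal) < (HYL.density ξ₁ : EReal) ∧
        (HYL.density ξ₂ : EReal) < ((μs / a : ℝ) : EReal)) ∧
      -- uniqueness of the critical parameter
      (∀ μ' ∈ Ioo (HYL.muTang d β α a b) (HYL.muP d β α a b),
        (∀ μ : ℝ, μ ≠ μ' → ∃ ξ : HYL.Ell1Plus, HYL.minimisers d β α a b μ = {ξ}) →
        (∃ ξ₁ ξ₂ : HYL.Ell1Plus, ξ₁ ≠ ξ₂ ∧ HYL.minimisers d β α a b μ' = {ξ₁, ξ₂}) →
        μ' = μs) ∧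
      -- the infimum is finite, differentiable away from `μs`, and not around `μs`
      (∃ f : ℝ → ℝ, (∀ μ : ℝ, (f μ : EReal) = ⨅ x : HYL.Ell1Plus, HYL.F d β α a b μ x) ∧
        DifferentiableOn ℝ f (Iio μs ∪ Ioi μs) ∧
        ∀ U : Set ℝ, IsOpen U → μs ∈ U → ¬ DifferentiableOn ℝ f U) := by
  have h : HYL.Regime d β α a b := ⟨hd, hβ, hα, hb, hba, hbstar⟩
  obtain ⟨lt, lg, lc, B⟩ := h.dualPair.exists_branches ha h.slopeCoef_pos
  have hdip : ∃ l, 0 ≤ l ∧ HYL.critPot (HYL.gasDensity d β α b) a (HYL.slopeCoef a b) l <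
      HYL.critPot (HYL.gasDensity d β α b) a (HYL.slopeCoef a b) 0 := by
    by_cases hc : 5 ≤ d ∨ α < 0
    · exact h.exists_lt_of_slope (hslope hc)
    · rw [not_or, not_le, not_lt] at hc
      exact h.exists_lt_of_le_four (by omega) (le_antisymm hα hc.2)
  have hlt : 0 < lt := by
    obtain ⟨l, hl, hll⟩ := hdip
    refine B.lt_nonneg.lt_of_ne fun he => ?_
    have := B.min l hl
    rw [← he] at this
    linarith
  obtain ⟨μs, hμs, h1, h2, h3⟩ := h.exists_transition B hlt
  rw [h.muTang_eq B, h.muP_eq]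
  refine ⟨μs, hμs, h1, h2, fun μ' _ _ ⟨ξ₁, ξ₂, hne, hmin⟩ => ?_, h3⟩
  by_contra hμ'
  obtain ⟨ξ, hξ⟩ := h1 μ' hμ'
  rw [hmin] at hξ
  have e1 : ξ₁ ∈ ({ξ} : Set HYL.Ell1Plus) := hξ ▸ Or.inl rfl
  have e2 : ξ₂ ∈ ({ξ} : Set HYL.Ell1Plus) := hξ ▸ Or.inr rfl
  exact hne (e1.trans e2.symm)
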